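/- **Model.** $\lg=\log_2$. We work in the external memory (I/O) model: a disk block consists of $B$ words of $w$ bits each, the representation of a tree is a string of bits stored contiguously on disk, one I/O reads one disk block, internal memory consists of $O(B)$ words, computation in internal memory is free, and the query algorithm may depend on the parameters ($N,B,w$, the key length, $\tau$ or $\epsilon$) but not on the tree or its keys. Throughout, $N\ge 2$, $B=\Omega(\lg N)$, $B\le N$ and $w=\Theta(\lg N)$. Trees are finite rooted ordinal trees of arbitrary degree. A node is given and reported by its identifier $(\ell,p)$, where the tree is cut into layers of $h$ consecutive levels (the topmost and the bottom layer may have fewer levels), $\ell$ is the number of the layer containing the node (the top layer has number $1$) and $p$ is the preorder number, starting from $1$, of the node among the nodes of this layer. The layer height $h$ depends only on the parameters, while the height of the topmost layer, between $1$ and $h$, may be chosen for each tree. **Theorem (trees with keys).** Let $0<\tau<1$ be a constant. A tree $T$ on $N$ nodes with $q$-bit keys, where $q\ge 1$ and $q=O(\lg N)$, can be represented, with layers of some height $1\le h\le\max(1,\tau B)$, in at most $$(2+q)N+q\cdot\left[\frac{2\tau N(q+2\lg B)}{w}+o(N)\right]+\frac{8\tau N\lg B}{w}$$ bits such that, given any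 node, the path from this node to the root (the identifiers and the keys of its nodes, in this order) can be reported in $O\!\left(\frac{K}{\tau B}+1\right)$ I/Os, where $K$ is the length of the path. The $o(N)$ term depends only on $N$, on $\tau$ and on the constants in the assumptions on $B$, $w$ and $q$; the constants in the $O$-bounds for the number of I/Os and for the internal memory depend only on the latter constants, not on $\tau$. **Corollary (trees without keys).** Let $0<\epsilon<1$ be a constant. A tree $T$ on $N$ nodes can be represented, with layers of some height $1\le h\le\max(1,\epsilon B)$, in at most $$2N+\frac{\epsilon N\lg B}{w}+o(N)$$ bits such that, given any node, the path from this node to the root (the identifiers of its nodes, in this order) can be reported in $O\!\left(\frac{K}{B}+1\right)$ I/Os, where $K$ is the length of the path. The $o(N)$ term depends only on $N$, on $\epsilon$ and on the constants in the assumptions on $B$ and $w$; the constants in the $O$-bounds for the number of I/Os and for the internal memory depend only on $\epsilon$ and those constants. -/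

import Mathlib

/-! ### Ordinal trees -/

/-- A finite ordinal (rooted, ordered) tree of arbitrary degree, in the standard Ulam--Harris
form: a node is the list of child indices leading to it from the root; so `[]` is the root and
`u ++ [i]` is the `i`-th child (counted from `0`) of `u`. -/
structure OrdinalTree where
  nodes : Finset (List ℕ)
  root_mem : [] ∈ nodes
  parent_mem : ∀ (u : List ℕ) (i : ℕ), u ++ [i] ∈ nodes → u ∈ nodes
  sibling_mem : ∀ (u : List ℕ) (i j : ℕ), j < i → u ++ [i] ∈ nodes → u ++ [j] ∈ nodes

/-- The path from the node `u` up to the root: `u`, its parent, ..., `[]`. It has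
`u.length` edges. -/
def rootPath (u : List ℕ) : List (List ℕ) := u.inits.reverse

/-- Cut a tree into layers of `h` consecutive levels, except that the topmost layer consists of
the first `r` levels only (`1 ≤ r ≤ h`) and that the bottom layer may be incomplete.
The number of the layer (starting from `1`) of a node at depth `d`. -/
def layerOfDepth (h r d : ℕ) : ℕ := if d < r then 1 else 2 + (d - r) / h

/-- The identifier `(ℓ, p)` of a node `u`: `ℓ` is the number of the layer containing `u` and `p`
is the preorder number (starting from `1`) of `u` among the nodes of this layer.
Preorder is the lexicographic order of Ulam--Harris lists (an ancestor precedes its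
descendants). -/
def OrdinalTree.ident (T : OrdinalTree) (h r : ℕ) (u : List ℕ) : ℕ × ℕ :=
  (layerOfDepth h r u.length,
    (T.nodes.filter fun v =>
      layerOfDepth h r v.length = layerOfDepth h r u.length ∧ v ≤ u).card)

/-! ### The external memory (I/O) model -/

/-- The `a`-th disk block (from `0`), of `b` bits, of a disk on which the bit string `D` is
stored contiguously; bits beyond the end of `D` read as `false`. -/
def diskBlock (D : List Bool) (b a : ℕ) : Fin b → Bool := fun j => D.getD (a * b + j) false

/-- A (read-only) query algorithm in the I/O model, with disk blocks of `b` bits and an internal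
memory of `m` bits besides the buffer that receives a block. Queries are of type `Q`, reported
items of type `O`. As usual in this model, computation in internal memory is free of charge. -/
structure DiskProgram (Q O : Type) (b m : ℕ) where
  /-- the initial content of the internal memory on a given query -/
  start : Q → (Fin m → Bool)
  /-- the number of the next disk block to be read; `none` means that the algorithm halts -/
  next : (Fin m → Bool) → Option ℕ
  /-- the new content of the internal memory, and the items that are reported, after a disk block
  has been read -/
  receive : (Fin m → Bool) → (Fin b → Bool) → (Fin m → Bool) × List O

/-- `P.Runs D s out n`: started with internal memory `s` on the disk content `D`, the algorithm
`P` halts after exactly `n` I/Os (reads of one disk block), having reported the list `out`. -/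
inductive DiskProgram.Runs {Q O : Type} {b m : ℕ} (P : DiskProgram Q O b m) (D : List Bool) :
    (Fin m → Bool) → List O → ℕ → Prop
  | halt (s : Fin m → Bool) : P.next s = none → Runs P D s [] 0
  | read (s : Fin m → Bool) (a : ℕ) (out : List O) (n : ℕ) : P.next s = some a →
      Runs P D (P.receive s (diskBlock D b a)).1 out n →
      Runs P D s ((P.receive s (diskBlock D b a)).2 ++ out) (n + 1)

/-- On the disk content `D`, given the identifier of any node `u` of `T`, the algorithm `P` reports
the whole node-to-root path of `u`, in this order and each node `v` in the form `item v`, and the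
number of I/Os is at most `io K`, where `K` is the length of the path. -/
def DiskProgram.ReportsRootPaths {O : Type} {b m : ℕ} (P : DiskProgram (ℕ × ℕ) O b m)
    (D : List Bool) (T : OrdinalTree) (h r : ℕ) (item : List ℕ → O) (io : ℕ → ℝ) : Prop :=
  ∀ u ∈ T.nodes, ∃ n : ℕ, (n : ℝ) ≤ io u.length ∧
    P.Runs D (P.start (T.ident h r u)) ((rootPath u).map item) n

/-- The binary logarithm. -/
noncomputable def lg (x : ℝ) : ℝ := Real.logb 2 x

/-- The standing assumptions on a tree with `N ≥ 2` nodes, the block size `B` (in words) and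
the word size `w` (in bits): `B = Ω(lg N)`, `B ≤ N` and `w = Θ(lg N)`, with explicit constants. -/
structure ModelAssumptions (cB cw Cw : ℝ) (N B w : ℕ) : Prop where
  two_le : 2 ≤ N
  block_lower : cB * lg N ≤ B
  block_upper : B ≤ N
  word_lower : cw * lg N ≤ w
  word_upper : w ≤ Cw * lg N

/-!
A tree is cut into layers of `h ≈ τ * B` levels, and its nodes are sorted by layers and in preorder
within a layer. The position of a node in this order is the number of nodes in earlier layers plus
its preorder number in its own layer, minus one.

*Ancestors in a layer.* Nodes that follow `a` in preorder and precede a descendant of `a` are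
descendants of `a`. Hence the ancestor at relative depth `k`, in its layer, of the node at position
`i` is at the last position up to `i` with relative depth `k`
(`OrdinalTree.relDepth_lt_relDepthAt`), so the sequence `δ` of relative depths is all that has to be
known. Since `δ (i + 1) ≤ δ i + 1`, the numbers `2 * i - δ i` increase strictly, and a bit vector of
length `2 * N` with these bits set represents `δ` (`Layout.Fits.mark_strictMono`).

*Blocks.* The positions are cut into blocks of about `4 * B * w / (q + 2)` positions, whose part of
the bit vector and whose keys fit into a constant number of disk blocks. For each relative depth
`k < h`, the record of a block has the last earlier position with relative depth `k`, together with
its key. A superblock consists of about `log log N` blocks, and a position is stored relative to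
the superblock in about `2 * lg B` bits (`SizeAssumptions.nearWidth_le_lg`); positions before the
superblock are found in a record of the superblock, of which there are so few that it can afford
full positions. The block records are the only part, apart from the bit vector and the keys, that is
not of lower order (`SizeAssumptions.length_le`).

*From layer to layer.* By averaging, the height of the topmost layer can be chosen such that only
`N / h + 1` nodes are on top levels of layers (`OrdinalTree.exists_few_layer_tops`). The
positions of their parents are monotone (`OrdinalTree.pos_dropLast_le`), and so are the starting
positions of the layers. A monotone sequence of `O(N / log N)` terms up to `2 * N` is stored in
`o(N)` bits such that a term is found with `O(1)` I/Os: groups of `log N` terms are stored relative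
to their first terms, with a field width for each group (`sum_groupWidth_le`).

So each layer of a path costs a constant number of I/Os, in one round of the query algorithm
(`OrdinalTree.eval_round`), and a path of length `K` meets at most `K / h + 2` layers. Rounds are
written as adaptive block readers, which are turned into a disk program by keeping the blocks read
in the current round in the internal memory (`BlockReader.exists_diskProgram`).
-/

/-! ### Query algorithms as adaptive block readers -/

/-- A finite computation that adaptively reads disk blocks of `b` bits and returns a value: either
it is done, or it reads the block with a given number and continues depending on the content. -/
inductive BlockReader (b : ℕ) (α : Type) : Type where
  | done (a : α) : BlockReader b α
  | read (a : ℕ) (k : (Fin b → Bool) → BlockReader b α) : BlockReader b α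

namespace BlockReader

variable {b : ℕ} {α β : Type}

/-- Sequential composition. -/
def bind : BlockReader b α → (α → BlockReader b β) → BlockReader b β
  | done a, f => f a
  | read a k, f => read a fun x => (k x).bind f

/-- The value returned on the disk content `D`. -/
def eval (D : List Bool) : BlockReader b α → α
  | done a => a
  | read a k => (k (diskBlock D b a)).eval D

/-- `p.DepthLE n`: the computation `p` reads at most `n` blocks, whatever their content. -/
def DepthLE : BlockReader b α → ℕ → Prop
  | done _, _ => True
  | read _ _, 0 => False
  | read _ k, n + 1 => ∀ x, (k x).DepthLE n

theorem eval_bind (D : List Bool) (p : BlockReader b α) (f : α → BlockReader b β) :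
    (p.bind f).eval D = (f (p.eval D)).eval D := by
  induction p with
  | done a => rfl
  | read a k ih => exact ih _

theorem DepthLE.mono {p : BlockReader b α} {m n : ℕ} (h : p.DepthLE m) (hmn : m ≤ n) :
    p.DepthLE n := by
  induction p generalizing m n with
  | done a => trivial
  | read a k ih =>
    cases m with
    | zero => exact h.elim
    | succ m =>
      obtain ⟨n, rfl⟩ : ∃ n', n = n' + 1 := ⟨n - 1, by omega⟩
      exact fun x => ih x (h x) (by omega)

theorem DepthLE.bind {p : BlockReader b α} {f : α → BlockReader b β} {m n : ℕ}
    (hp : p.DepthLE m) (hf : ∀ a, (f a).DepthLE n) : (p.bind f).DepthLE (m + n) := by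
  induction p generalizing m with
  | done a => exact (hf a).mono (by omega)
  | read a k ih =>
    cases m with
    | zero => exact hp.elim
    | succ m =>
      rw [Nat.succ_add]
      exact fun x => ih x (hp x)

/-- The computation that remains after the contents of the first blocks have been supplied. -/
def feed : BlockReader b α → List (Fin b → Bool) → BlockReader b α
  | p, [] => p
  | done a, _ :: _ => done a
  | read _ k, x :: l => (k x).feed l

theorem feed_nil (p : BlockReader b α) : p.feed [] = p := by
  cases p <;> rfl

theorem feed_append (p : BlockReader b α) (l l' : List (Fin b → Bool)) :
    p.feed (l ++ l') = (p.feed l).feed l' := by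
  induction l generalizing p with
  | nil => simp [feed]
  | cons x l ih =>
    cases p with
    | done a => cases l' <;> simp [feed]
    | read a k => simpa [feed] using ih (k x)

/-- Read `k` consecutive blocks starting with block `a`. The result is a view of the disk by
absolute bit positions; it agrees with `acc` outside of the blocks read. -/
def readBlocks (hb : 0 < b) (a : ℕ) : ℕ → (ℕ → Bool) → BlockReader b (ℕ → Bool)
  | 0, acc => done acc
  | k + 1, acc => read (a + k) fun x =>
      readBlocks hb a k fun i => if i / b = a + k then x ⟨i % b, Nat.mod_lt _ hb⟩ else acc i

theorem depthLE_readBlocks (hb : 0 < b) (a k : ℕ) (acc : ℕ → Bool) :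
    (readBlocks hb a k acc).DepthLE k := by
  induction k generalizing acc with
  | zero => trivial
  | succ k ih => exact fun x => ih _

theorem eval_readBlocks (hb : 0 < b) (D : List Bool) (a k : ℕ) (acc : ℕ → Bool) (i : ℕ) :
    (readBlocks hb a k acc).eval D i =
      if a ≤ i / b ∧ i / b < a + k then D.getD i false else acc i := by
  induction k generalizing acc with
  | zero =>
    have : ¬ (a ≤ i / b ∧ i / b < a + 0) := by omega
    simp only [readBlocks, eval, if_neg this]
  | succ k ih =>
    simp only [readBlocks, eval, ih]
    by_cases h1 : i / b = a + k
    · have h2 : ¬ (a ≤ i / b ∧ i / b < a + k) := by omega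
      have h3 : a ≤ i / b ∧ i / b < a + (k + 1) := by omega
      rw [if_neg h2, if_pos h3, if_pos h1]
      simp only [diskBlock]
      rw [← h1, Nat.div_add_mod']
    · by_cases h2 : a ≤ i / b ∧ i / b < a + k
      · rw [if_pos h2, if_pos (by omega)]
      · rw [if_neg h2, if_neg h1, if_neg (by omega)]

/-- Read all blocks that meet the bit positions `x, ..., x + len - 1`. -/
def readRange (hb : 0 < b) (x len : ℕ) : BlockReader b (ℕ → Bool) :=
  readBlocks hb (x / b) (len / b + 2) fun _ => false

theorem depthLE_readRange (hb : 0 < b) (x len : ℕ) :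
    (readRange hb x len).DepthLE (len / b + 2) :=
  depthLE_readBlocks _ _ _ _

theorem eval_readRange (hb : 0 < b) (D : List Bool) {x len i : ℕ} (h1 : x ≤ i)
    (h2 : i < x + len) : (readRange hb x len).eval D i = D.getD i false := by
  have h3 : x / b ≤ i / b := Nat.div_le_div_right h1
  have h4 : i / b < x / b + (len / b + 2) := by
    rw [Nat.div_lt_iff_lt_mul hb]
    have e1 := Nat.div_add_mod x b
    have e2 := Nat.div_add_mod len b
    have l1 := Nat.mod_lt x hb
    have l2 := Nat.mod_lt len hb
    have : (x / b + (len / b + 2)) * b = b * (x / b) + b * (len / b) + b + b := by ring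
    omega
  rw [readRange, eval_readBlocks, if_pos ⟨h3, h4⟩]

/-- `Rounds D round s out n`: on the disk content `D`, iterating `round` from the state `s` until
it returns no further state takes `n` rounds, and reports `out`. -/
inductive Rounds {σ O : Type} (D : List Bool) (round : σ → BlockReader b (List O × Option σ)) :
    σ → List O → ℕ → Prop
  | last (s : σ) (out : List O) : (round s).eval D = (out, none) → Rounds D round s out 1
  | step (s s' : σ) (out out' : List O) (n : ℕ) : (round s).eval D = (out, some s') →
      Rounds D round s' out' n → Rounds D round s (out ++ out') (n + 1)

/-- The internal memory while a round is executed: the state at the beginning of the round and the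
contents of the at most `c` blocks read in this round so far; `none` once the algorithm is done. -/
abbrev Memory (σ : Type) (b c : ℕ) : Type :=
  Option (σ × {l : List (Fin b → Bool) // l.length ≤ c})

theorem exists_memory_embedding (σ : Type) [Fintype σ] (b c m₀ m : ℕ)
    (hσ : Fintype.card σ ≤ 2 ^ m₀) (hm : 1 + m₀ + c + c * b ≤ m) :
    Nonempty (Memory σ b c ↪ (Fin m → Bool)) := by
  let e : Memory σ b c → Option (σ × Fin (c + 1) × (Fin c → Fin b → Bool)) :=
    Option.map fun s => (s.1, ⟨s.2.1.length, by have := s.2.2; omega⟩,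
      fun i => s.2.1.getD i fun _ => false)
  have he : Function.Injective e := by
    apply Option.map_injective
    rintro ⟨s, l, hl⟩ ⟨s', l', hl'⟩ h
    simp only [Prod.mk.injEq, Fin.mk.injEq] at h
    obtain ⟨rfl, h1, h2⟩ := h
    simp only [Prod.mk.injEq, Subtype.mk.injEq, true_and]
    refine List.ext_getElem h1 fun i hi hi' => ?_
    have := congrFun h2 ⟨i, by omega⟩
    simpa only [List.getD_eq_getElem _ _ hi, List.getD_eq_getElem _ _ hi'] using this
  have hc : Fintype.card (Option (σ × Fin (c + 1) × (Fin c → Fin b → Bool)))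
      ≤ Fintype.card (Fin m → Bool) := by
    simp only [Fintype.card_option, Fintype.card_prod, Fintype.card_fin, Fintype.card_fun,
      Fintype.card_bool]
    have h1 : c + 1 ≤ 2 ^ c := Nat.lt_two_pow_self
    have h2 : Fintype.card σ * ((c + 1) * (2 ^ b) ^ c) ≤ 2 ^ m₀ * (2 ^ c * 2 ^ (c * b)) := by
      have : (2 ^ b) ^ c = 2 ^ (c * b) := by rw [← pow_mul, mul_comm]
      rw [this]
      gcongr
    have h3 : 1 ≤ 2 ^ m₀ * (2 ^ c * 2 ^ (c * b)) := Nat.one_le_iff_ne_zero.2 (by positivity)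
    calc _ ≤ 2 * (2 ^ m₀ * (2 ^ c * 2 ^ (c * b))) := by omega
      _ = 2 ^ (1 + m₀ + c + c * b) := by ring
      _ ≤ 2 ^ m := Nat.pow_le_pow_right (by norm_num) hm
  obtain ⟨g⟩ := Function.Embedding.nonempty_of_card_le hc
  exact ⟨⟨_, g.injective.comp he⟩⟩

/-- One step of the execution of a round: supply the content `x` of the next block. At the end of
the round one block is read in vain, since the model reports items only after an I/O. The case that
the list of blocks becomes too long does not occur in rounds of at most `c` reads. -/
def advance {σ O : Type} {c : ℕ} (round : σ → BlockReader b (List O × Option σ)) :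
    Memory σ b c → (Fin b → Bool) → Memory σ b c × List O
  | none, _ => (none, [])
  | some (s, l), x => match (round s).feed l.1 with
    | done (out, s') => (s'.map fun s' => (s', ⟨[], Nat.zero_le _⟩), out)
    | read _ _ => (if h : (l.1 ++ [x]).length ≤ c then some (s, ⟨l.1 ++ [x], h⟩) else none, [])

/-- The number of the next block to be read in the execution of a round. -/
def nextBlock {σ O : Type} {c : ℕ} (round : σ → BlockReader b (List O × Option σ)) :
    Memory σ b c → Option ℕ
  | none => none
  | some (s, l) => match (round s).feed l.1 with
    | done _ => some 0
    | read a _ => some a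

/-- Rounds of at most `c` reads are executed by a disk program whose internal memory holds the
state and `c` blocks, with at most `c + 1` I/Os per round. -/
theorem exists_diskProgram {Q O σ : Type} [Fintype σ] {c m₀ m : ℕ}
    (round : σ → BlockReader b (List O × Option σ)) (hround : ∀ s, (round s).DepthLE c)
    (start : Q → σ) (hσ : Fintype.card σ ≤ 2 ^ m₀) (hm : 1 + m₀ + c + c * b ≤ m) :
    ∃ P : DiskProgram Q O b m, ∀ (D : List Bool) (i : Q) (out : List O) (n : ℕ),
      Rounds D round (start i) out n → ∃ k ≤ n * (c + 1), P.Runs D (P.start i) out k := by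
  classical
  obtain ⟨e⟩ := exists_memory_embedding σ b c m₀ m hσ hm
  have hinv : ∀ s, Function.invFun e (e s) = s := Function.leftInverse_invFun e.injective
  let init : σ → Memory σ b c := fun s => some (s, ⟨[], Nat.zero_le _⟩)
  let P : DiskProgram Q O b m :=
    { start := fun i => e (init (start i))
      next := fun s => nextBlock round (Function.invFun e s)
      receive := fun s x => (e (advance round (Function.invFun e s) x).1,
        (advance round (Function.invFun e s) x).2) }
  have hhalt : ∀ D, P.Runs D (e none) [] 0 := fun D =>
    .halt _ (by simp [P, hinv, nextBlock])
  have hrun : ∀ (D : List Bool) (s : σ) (p : BlockReader b (List O × Option σ))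
      (l : List (Fin b → Bool)) (hl : l.length ≤ c) (d : ℕ) (out out' : List O) (n : ℕ),
      (round s).feed l = p → p.DepthLE d → l.length + d ≤ c → (p.eval D).1 = out →
      P.Runs D (e ((p.eval D).2.map fun s' => (s', ⟨[], Nat.zero_le _⟩))) out' n →
      ∃ k ≤ d + 1 + n, P.Runs D (e (some (s, ⟨l, hl⟩))) (out ++ out') k := by
    intro D s p
    induction p with
    | done a =>
      intro l hl d out out' n hp _ _ hout hn
      refine ⟨n + 1, by omega, ?_⟩
      subst hout
      have h1 : advance round (some (s, ⟨l, hl⟩)) (diskBlock D b 0) =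
          (a.2.map fun s' => (s', ⟨[], Nat.zero_le _⟩), a.1) := by simp [advance, hp]
      have := DiskProgram.Runs.read (P := P) (D := D) (e (some (s, ⟨l, hl⟩))) 0 out' n
        (by simp [P, hinv, nextBlock, hp]) (by simp only [P, hinv, h1]; exact hn)
      simp only [P, hinv, h1] at this
      exact this
    | read a k ih =>
      intro l hl d out out' n hp hd hld hout hn
      cases d with
      | zero => exact hd.elim
      | succ d =>
        have hlen : (l ++ [diskBlock D b a]).length ≤ c := by
          rw [List.length_append, List.length_singleton]; omega
        obtain ⟨k', hk', hr⟩ := ih (diskBlock D b a) (l ++ [diskBlock D b a]) hlen d out out' n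
          (by rw [feed_append, hp]; simp [feed]) (hd _)
          (by rw [List.length_append, List.length_singleton]; omega) hout hn
        have h1 : advance round (some (s, ⟨l, hl⟩)) (diskBlock D b a) =
            (some (s, ⟨l ++ [diskBlock D b a], hlen⟩), []) := by
          simp only [advance, hp]
          rw [dif_pos hlen]
        refine ⟨k' + 1, by omega, ?_⟩
        have := DiskProgram.Runs.read (P := P) (D := D) (e (some (s, ⟨l, hl⟩))) a (out ++ out') k'
          (by simp [P, hinv, nextBlock, hp]) (by simp only [P, hinv, h1]; exact hr)
        simp only [P, hinv, h1, List.nil_append] at this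
        exact this
  have key : ∀ D s out n, Rounds D round s out n →
      ∃ k ≤ n * (c + 1), P.Runs D (e (init s)) out k := by
    intro D s out n hs
    induction hs with
    | last s out h =>
      obtain ⟨k, hk, hr⟩ := hrun D s (round s) [] (Nat.zero_le _) c out [] 0 (feed_nil _) (hround s)
        (by simp) (by rw [h]) (by rw [h]; exact hhalt D)
      exact ⟨k, by omega, by simpa using hr⟩
    | step s s' out out' n h _ ih =>
      obtain ⟨k', hk', hr'⟩ := ih
      obtain ⟨k, hk, hr⟩ := hrun D s (round s) [] (Nat.zero_le _) c out out' k' (feed_nil _) (hround s)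
        (by simp) (by rw [h]) (by rw [h]; exact hr')
      exact ⟨k, by rw [Nat.succ_mul]; omega, hr⟩
  exact ⟨P, fun D i out n hn => key D _ out n hn⟩

end BlockReader

/-! ### Bit strings holding numbers -/

/-- The number whose `w` binary digits, least significant first, are the bits of `v` from position
`x` on. -/
def natAt (v : ℕ → Bool) (x w : ℕ) : ℕ := Nat.ofBits fun i : Fin w => v (x + i)

/-- The `w` lowest binary digits of `n`, least significant first. -/
def bitsOf (w n : ℕ) : List Bool := List.ofFn fun i : Fin w => n.testBit i

/-- From position `x` on, the bits of `v` are those of the string `l`. -/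
def Holds (v : ℕ → Bool) (x : ℕ) (l : List Bool) : Prop :=
  ∀ t < l.length, v (x + t) = l.getD t false

@[simp] theorem length_bitsOf (w n : ℕ) : (bitsOf w n).length = w := by simp [bitsOf]

theorem natAt_congr {v v' : ℕ → Bool} {x w : ℕ} (h : ∀ i, x ≤ i → i < x + w → v i = v' i) :
    natAt v x w = natAt v' x w := by
  unfold natAt
  congr 1
  funext i
  exact h _ (by omega) (by omega)

theorem natAt_eq_of_holds {v : ℕ → Bool} {x w n : ℕ} (h : Holds v x (bitsOf w n))
    (hn : n < 2 ^ w) : natAt v x w = n := by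
  have : (fun i : Fin w => v (x + i)) = fun i : Fin w => n.testBit i := by
    funext i
    rw [h i (by simp), List.getD_eq_getElem _ _ (by simp)]
    simp [bitsOf]
  rw [natAt, this, Nat.ofBits_testBit, Nat.mod_eq_of_lt hn]

theorem holds_getD (D : List Bool) : Holds (fun i => D.getD i false) 0 D := by
  intro t _
  simp

theorem Holds.left {v : ℕ → Bool} {x : ℕ} {l l' : List Bool} (h : Holds v x (l ++ l')) :
    Holds v x l := by
  intro t ht
  rw [h t (by rw [List.length_append]; omega), List.getD_append _ _ _ _ ht]

theorem Holds.right {v : ℕ → Bool} {x : ℕ} {l l' : List Bool} (h : Holds v x (l ++ l')) :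
    Holds v (x + l.length) l' := by
  intro t ht
  rw [Nat.add_assoc, h (l.length + t) (by rw [List.length_append]; omega),
    List.getD_append_right _ _ _ _ (by omega), Nat.add_sub_cancel_left]

theorem length_flatMap_range (p : ℕ → List Bool) (n : ℕ) :
    ((List.range n).flatMap p).length = ∑ i ∈ Finset.range n, (p i).length := by
  induction n with
  | zero => simp
  | succ n ih => simp [List.range_succ, Finset.sum_range_succ, ih]

theorem Holds.flatMap {v : ℕ → Bool} {x n : ℕ} {p : ℕ → List Bool}
    (h : Holds v x ((List.range n).flatMap p)) {t : ℕ} (ht : t < n) :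
    Holds v (x + ∑ i ∈ Finset.range t, (p i).length) (p t) := by
  induction n with
  | zero => omega
  | succ n ih =>
    rw [List.range_succ, List.flatMap_append] at h
    rcases Nat.lt_succ_iff_lt_or_eq.1 ht with h1 | rfl
    · exact ih h.left h1
    · have := h.right
      rwa [length_flatMap_range, List.flatMap_singleton] at this

theorem length_flatMap_range_const {p : ℕ → List Bool} {w : ℕ} (hp : ∀ i, (p i).length = w)
    (n : ℕ) : ((List.range n).flatMap p).length = n * w := by
  simp [hp]

theorem Holds.flatMap_const {v : ℕ → Bool} {x n w : ℕ} {p : ℕ → List Bool}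
    (h : Holds v x ((List.range n).flatMap p)) (hp : ∀ i, (p i).length = w) {t : ℕ}
    (ht : t < n) : Holds v (x + t * w) (p t) := by
  simpa [hp] using h.flatMap ht

/-! ### Monotone sequences with constant-time access -/

/-- The width of the fields for the `t`-th group of `s` consecutive terms of a monotone sequence,
which are stored relative to the first term of the group. -/
def groupWidth (a : ℕ → ℕ) (s t : ℕ) : ℕ := Nat.size (a (t * s + s) - a (t * s))

/-- The terms of the `t`-th group relative to the first one. -/
def groupData (a : ℕ → ℕ) (s t : ℕ) : List Bool :=
  (List.range s).flatMap fun k => bitsOf (groupWidth a s t) (a (t * s + k) - a (t * s))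

/-- The header of the `t`-th group, with fields of `b` bits: its first term, the position of its
data, and their width. -/
def groupHeader (a : ℕ → ℕ) (s b t : ℕ) : List Bool :=
  bitsOf b (a (t * s)) ++ (bitsOf b (∑ i ∈ Finset.range t, s * groupWidth a s i) ++
    bitsOf b (groupWidth a s t))

/-- The representation of the first `g` groups of a monotone sequence. -/
def monoBits (a : ℕ → ℕ) (s b g : ℕ) : List Bool :=
  (List.range g).flatMap (groupHeader a s b) ++ (List.range g).flatMap (groupData a s)

theorem length_groupData (a : ℕ → ℕ) (s t : ℕ) :
    (groupData a s t).length = s * groupWidth a s t := by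
  rw [groupData, length_flatMap_range_const fun i => length_bitsOf _ _]

theorem length_groupHeader (a : ℕ → ℕ) (s b t : ℕ) : (groupHeader a s b t).length = 3 * b := by
  simp [groupHeader]; ring

theorem length_monoBits (a : ℕ → ℕ) (s b g : ℕ) : (monoBits a s b g).length =
    g * (3 * b) + s * ∑ t ∈ Finset.range g, groupWidth a s t := by
  rw [monoBits, List.length_append, length_flatMap_range_const (length_groupHeader a s b),
    length_flatMap_range, Finset.mul_sum]
  simp only [length_groupData]

theorem Nat.size_le_add_div_two_pow (x c : ℕ) : Nat.size x ≤ c + x / 2 ^ c := by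
  rw [Nat.size_le, pow_add]
  calc x < 2 ^ c * (x / 2 ^ c + 1) := by
        have := Nat.lt_div_mul_add (a := x) (b := 2 ^ c) (by positivity)
        rw [mul_add, mul_comm, mul_one]; exact this
    _ ≤ 2 ^ c * 2 ^ (x / 2 ^ c) := Nat.mul_le_mul_left _ Nat.lt_two_pow_self

/-- The sum of the logarithms of the group spans is bounded through `Nat.size x ≤ c + x / 2 ^ c`,
as the spans add up to at most the last term. -/
theorem sum_groupWidth_le {a : ℕ → ℕ} (ha : Monotone a) {U : ℕ} (hU : ∀ i, a i ≤ U) (s g c : ℕ) :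
    ∑ t ∈ Finset.range g, groupWidth a s t ≤ g * c + U / 2 ^ c := by
  have h1 : ∀ g, ∑ t ∈ Finset.range g, groupWidth a s t ≤
      g * c + (a (g * s) - a 0) / 2 ^ c := by
    intro g
    induction g with
    | zero => simp
    | succ g ih =>
      rw [Finset.sum_range_succ]
      have h2 := Nat.size_le_add_div_two_pow (a (g * s + s) - a (g * s)) c
      have h3 : (a (g * s) - a 0) / 2 ^ c + (a (g * s + s) - a (g * s)) / 2 ^ c ≤
          (a ((g + 1) * s) - a 0) / 2 ^ c := by
        refine Nat.div_add_div_le_add_div.trans (Nat.div_le_div_right ?_)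
        have e : (g + 1) * s = g * s + s := by ring
        have := ha (Nat.zero_le (g * s))
        have := ha (Nat.le_add_right (g * s) s)
        rw [e]; omega
      unfold groupWidth at *
      have e : (g + 1) * c = g * c + c := by ring
      omega
  refine (h1 g).trans (Nat.add_le_add_left (Nat.div_le_div_right ?_) _)
  have := hU (g * s)
  omega

theorem length_monoBits_le {a : ℕ → ℕ} (ha : Monotone a) {U : ℕ} (hU : ∀ i, a i ≤ U)
    (s b g c : ℕ) :
    (monoBits a s b g).length ≤ g * (3 * b) + s * (g * c + U / 2 ^ c) := by
  rw [length_monoBits]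
  exact Nat.add_le_add_left (Nat.mul_le_mul_left _ (sum_groupWidth_le ha hU s g c)) _

namespace BlockReader

variable {β : ℕ}

/-- Read the `i`-th term of the monotone sequence stored by `monoBits` at position `o`. The minimum
bounds the number of reads on arbitrary disk contents. -/
def readMono (hβ : 0 < β) (s b g o i : ℕ) : BlockReader β ℕ :=
  (readRange hβ (o + i / s * (3 * b)) (3 * b)).bind fun v =>
    let x := o + i / s * (3 * b)
    let y := o + g * (3 * b) + natAt v (x + b) b + i % s * natAt v (x + 2 * b) b
    (readRange hβ y (min (natAt v (x + 2 * b) b) b)).bind fun v' =>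
      done (natAt v x b + natAt v' y (natAt v (x + 2 * b) b))

theorem depthLE_readMono (hβ : 0 < β) (s b g o i : ℕ) :
    (readMono hβ s b g o i).DepthLE (3 * b / β + 2 + (b / β + 2)) := by
  refine (depthLE_readRange _ _ _).bind fun v => ?_
  refine DepthLE.mono (((depthLE_readRange _ _ _).mono ?_).bind (n := 0) fun _ => trivial)
    (le_refl _)
  exact Nat.add_le_add_right (Nat.div_le_div_right (min_le_right _ _)) _

theorem eval_readMono (hβ : 0 < β) {a : ℕ → ℕ} (ha : Monotone a) {U : ℕ} (hU : ∀ i, a i ≤ U)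
    {s b g o i : ℕ} (hs : 0 < s) (hUb : U < 2 ^ b) (hb : s * (g * b) < 2 ^ b) (hi : i < g * s)
    {D : List Bool} (hD : Holds (fun i => D.getD i false) o (monoBits a s b g)) :
    (readMono hβ s b g o i).eval D = a i := by
  have hg : i / s < g := by rwa [Nat.div_lt_iff_lt_mul hs]
  have hw : ∀ t, groupWidth a s t ≤ b := fun t =>
    Nat.size_le.2 (lt_of_le_of_lt ((Nat.sub_le _ _).trans (hU _)) hUb)
  set t := i / s with ht
  have hptr : ∑ i ∈ Finset.range t, s * groupWidth a s i < 2 ^ b := by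
    refine lt_of_le_of_lt ?_ hb
    rw [← Finset.mul_sum]
    refine Nat.mul_le_mul_left _ ((Finset.sum_le_card_nsmul _ _ b fun i _ => hw i).trans ?_)
    simpa using Nat.mul_le_mul_right b hg.le
  have hh := hD.left.flatMap_const (length_groupHeader a s b) hg
  have hd := hD.right.flatMap hg
  rw [length_flatMap_range_const (length_groupHeader a s b)] at hd
  simp only [length_groupData] at hd
  have hk := Holds.flatMap_const hd (fun i => length_bitsOf _ _) (Nat.mod_lt i hs)
  have h1 := natAt_eq_of_holds hh.left (lt_of_le_of_lt (hU _) hUb)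
  have h2 := natAt_eq_of_holds hh.right.left hptr
  have h3 := natAt_eq_of_holds hh.right.right
    (lt_of_le_of_lt (hw t) Nat.lt_two_pow_self)
  have hi' : t * s + i % s = i := Nat.div_add_mod' i s
  have h4 := natAt_eq_of_holds hk (lt_of_le_of_lt (Nat.sub_le_sub_right
    (ha (Nat.add_le_add_left (Nat.mod_lt i hs).le _)) _) (Nat.lt_size_self _))
  rw [length_bitsOf] at h2 h3
  rw [length_bitsOf] at h3
  set x := o + t * (3 * b) with hx
  have hv : ∀ i, x ≤ i → i < x + 3 * b →
      (readRange hβ x (3 * b)).eval D i = D.getD i false := fun i h h' => eval_readRange hβ D h h'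
  unfold readMono
  simp only [eval_bind, eval, ← ht, ← hx]
  have e1 : natAt ((readRange hβ x (3 * b)).eval D) x b = a (t * s) := by
    rw [← h1]; exact natAt_congr fun i h h' => hv i (by omega) (by omega)
  have e2 : natAt ((readRange hβ x (3 * b)).eval D) (x + b) b =
      ∑ i ∈ Finset.range t, s * groupWidth a s i := by
    rw [← h2]; exact natAt_congr fun i h h' => hv i (by omega) (by omega)
  have e3 : natAt ((readRange hβ x (3 * b)).eval D) (x + 2 * b) b = groupWidth a s t := by
    rw [← h3, two_mul, ← add_assoc]; exact natAt_congr fun i h h' => hv i (by omega) (by omega)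
  rw [e1, e2, e3, min_eq_left (hw t)]
  set y := o + g * (3 * b) + ∑ i ∈ Finset.range t, s * groupWidth a s i +
    i % s * groupWidth a s t with hy
  have e4 : natAt ((readRange hβ y (groupWidth a s t)).eval D) y (groupWidth a s t) =
      a i - a (t * s) := by
    rw [← hi', ← h4]
    exact natAt_congr fun i h h' => eval_readRange hβ D h h'
  rw [e4]
  have := ha (show t * s ≤ i by omega)
  omega

end BlockReader

/-! ### Preorder -/

theorem List.cons_le_cons_imp {x y : ℕ} {a b : List ℕ} (h : x :: a ≤ y :: b) :
    x < y ∨ x = y ∧ a ≤ b := by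
  rcases h.lt_or_eq with h | h
  · rcases List.cons_lt_cons_iff.1 h with h | ⟨h, h'⟩
    · exact Or.inl h
    · exact Or.inr ⟨h, le_of_lt h'⟩
  · rw [List.cons.injEq] at h
    exact Or.inr ⟨h.1, h.2.le⟩

theorem List.IsPrefix.le_lex {a b : List ℕ} (h : a <+: b) : a ≤ b := by
  induction a generalizing b with
  | nil =>
    cases b with
    | nil => exact le_rfl
    | cons y b => exact le_of_lt (List.nil_lt_cons y b)
  | cons x a ih =>
    obtain ⟨c, rfl⟩ := h
    rcases (ih (List.prefix_append a c)).lt_or_eq with h | h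
    · exact le_of_lt (List.cons_lt_cons_iff.2 (Or.inr ⟨rfl, h⟩))
    · rw [List.cons_append, ← h]

/-- The nodes between `a` and a descendant of `a` in preorder are descendants of `a`. -/
theorem List.IsPrefix.of_le_of_le {a b v : List ℕ} (h : a <+: b) (h1 : a ≤ v) (h2 : v ≤ b) :
    a <+: v := by
  induction a generalizing b v with
  | nil => exact List.nil_prefix
  | cons x a ih =>
    obtain ⟨c, rfl⟩ := h
    cases v with
    | nil => exact absurd (List.nil_lt_cons x a) (not_lt.2 h1)
    | cons y v =>
      rw [List.cons_append] at h2
      rcases List.cons_le_cons_imp h1 with h3 | ⟨rfl, h3⟩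
      · rcases List.cons_le_cons_imp h2 with h2 | ⟨rfl, h2⟩ <;> omega
      · rcases List.cons_le_cons_imp h2 with h2 | ⟨-, h2⟩
        · omega
        · exact (List.prefix_cons_inj x).2 (ih (List.prefix_append a c) h3 h2)

/-- Preorder on the nodes of one level is weakly inherited by their parents. -/
theorem List.dropLast_le_dropLast {u v : List ℕ} (hl : u.length = v.length) (h : u ≤ v) :
    u.dropLast ≤ v.dropLast := by
  by_contra! h'
  have h1 := (List.dropLast_prefix v).of_le_of_le h'.le
    ((List.dropLast_prefix u).le_lex.trans h)
  have h2 := h1.eq_of_length (by simp [hl])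
  exact absurd h2 (ne_of_lt h')

/-! ### Layers -/

/-- The depth, relative to the top level of its layer, of a node at depth `d`. -/
def relDepth (h r d : ℕ) : ℕ := if d < r then d else (d - r) % h

section Layers

variable {h r : ℕ}

theorem relDepth_le (d : ℕ) : relDepth h r d ≤ d := by
  unfold relDepth
  split_ifs
  · exact le_rfl
  · exact (Nat.mod_le _ _).trans (Nat.sub_le _ _)

theorem relDepth_lt (hh : 0 < h) (hr : r ≤ h) (d : ℕ) : relDepth h r d < h := by
  unfold relDepth
  split_ifs
  · omega
  · exact Nat.mod_lt _ hh

theorem layerOfDepth_mono : Monotone (layerOfDepth h r) := by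
  intro d d' hd
  unfold layerOfDepth
  have := Nat.div_le_div_right (c := h) (Nat.sub_le_sub_right hd r)
  generalize (d - r) / h = x at *
  generalize (d' - r) / h = y at *
  split_ifs <;> omega

theorem layerOfDepth_pos (d : ℕ) : 1 ≤ layerOfDepth h r d := by
  unfold layerOfDepth
  generalize (d - r) / h = x
  split_ifs <;> omega

theorem relDepth_add_of_layer_eq {d d' : ℕ} (hd : d ≤ d')
    (hl : layerOfDepth h r d = layerOfDepth h r d') :
    relDepth h r d' = relDepth h r d + (d' - d) := by
  unfold layerOfDepth at hl
  unfold relDepth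
  have p := Nat.zero_le ((d' - r) / h)
  split_ifs at hl ⊢
  · omega
  · omega
  · omega
  · have e1 := Nat.div_add_mod (d - r) h
    have e2 := Nat.div_add_mod (d' - r) h
    have : (d - r) / h = (d' - r) / h := by omega
    rw [this] at e1
    omega

theorem relDepth_succ_of_ne_zero {d : ℕ} (hd : relDepth h r (d + 1) ≠ 0) :
    layerOfDepth h r d = layerOfDepth h r (d + 1) := by
  unfold relDepth at hd
  unfold layerOfDepth
  by_cases h1 : d + 1 < r
  · rw [if_pos h1, if_pos (by omega)]
  · rw [if_neg h1] at hd ⊢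
    have h2 : ¬ d < r := by
      intro h2
      have : d + 1 - r = 0 := by omega
      simp [this] at hd
    rw [if_neg h2]
    have e : d + 1 - r = d - r + 1 := by omega
    rw [e] at hd ⊢
    rw [Nat.succ_div_of_not_dvd fun h3 => hd (Nat.mod_eq_zero_of_dvd h3)]

theorem layerOfDepth_succ_of_eq_zero {d : ℕ} (hd : relDepth h r (d + 1) = 0) :
    layerOfDepth h r (d + 1) = layerOfDepth h r d + 1 := by
  unfold relDepth at hd
  unfold layerOfDepth
  by_cases h1 : d + 1 < r
  · rw [if_pos h1] at hd
    omega
  · rw [if_neg h1] at hd ⊢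
    by_cases h2 : d < r
    · have : d + 1 - r = 0 := by omega
      rw [if_pos h2, this, Nat.zero_div]
    · rw [if_neg h2]
      have e : d + 1 - r = d - r + 1 := by omega
      rw [e] at hd ⊢
      rw [Nat.succ_div_of_dvd (Nat.dvd_of_mod_eq_zero hd)]
      omega

theorem layerOfDepth_sub_relDepth (hh : 0 < h) {d i : ℕ} (hi : i ≤ relDepth h r d) :
    layerOfDepth h r (d - i) = layerOfDepth h r d := by
  have := Nat.mod_le (d - r) h
  unfold relDepth at hi
  unfold layerOfDepth
  by_cases h1 : d < r
  · rw [if_pos h1, if_pos (by omega)]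
  · rw [if_neg h1] at hi ⊢
    rw [if_neg (by omega)]
    have e := Nat.div_add_mod (d - r) h
    have : (d - i - r) / h = (d - r) / h := by
      rw [show d - i - r = (d - r) / h * h + ((d - r) % h - i) by
        rw [mul_comm]; omega]
      rw [Nat.add_comm, Nat.add_mul_div_right _ _ hh,
        Nat.div_eq_of_lt (lt_of_le_of_lt (Nat.sub_le _ _) (Nat.mod_lt _ hh)), zero_add]
    rw [this]

theorem layerOfDepth_eq_one_iff (hr : 0 < r) {d : ℕ} :
    layerOfDepth h r d = 1 ↔ relDepth h r d = d := by
  unfold layerOfDepth relDepth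
  split_ifs with h1
  · simp
  · have := Nat.mod_le (d - r) h
    generalize (d - r) / h = x
    constructor <;> intro _ <;> omega

theorem layerOfDepth_le (d : ℕ) : layerOfDepth h r d ≤ d / h + 2 := by
  unfold layerOfDepth
  have := Nat.div_le_div_right (c := h) (Nat.sub_le d r)
  generalize (d - r) / h = x at *
  generalize d / h = y at *
  split_ifs <;> omega

end Layers

/-- Since each level below the root is the top level of a layer for only one height
`r ∈ {1, ..., h}` of the topmost layer, some `r` leads to few nodes on top levels of layers. -/
theorem OrdinalTree.exists_few_layer_tops (T : OrdinalTree) {h : ℕ} (hh : 0 < h) :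
    ∃ r, 1 ≤ r ∧ r ≤ h ∧
      (T.nodes.filter fun u => relDepth h r u.length = 0).card ≤ T.nodes.card / h + 1 := by
  classical
  let c : ℕ → ℕ := fun r => ((T.nodes.erase []).filter fun u => relDepth h r u.length = 0).card
  have hsum : ∑ r ∈ Finset.Icc 1 h, c r ≤ T.nodes.card := by
    simp only [c, Finset.card_filter]
    rw [Finset.sum_comm]
    refine (Finset.sum_le_card_nsmul _ _ 1 fun u hu => ?_).trans ?_
    · rw [← Finset.card_filter, Finset.card_le_one]
      have hu' : u.length ≠ 0 := by
        simpa using (Finset.mem_erase.1 hu).1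
      intro r hr r' hr'
      obtain ⟨hr, hr0⟩ := Finset.mem_filter.1 hr
      obtain ⟨hr', hr0'⟩ := Finset.mem_filter.1 hr'
      rw [Finset.mem_Icc] at hr hr'
      unfold relDepth at hr0 hr0'
      split_ifs at hr0 hr0' <;> try omega
      by_contra hne
      have h1 := Nat.dvd_of_mod_eq_zero hr0
      have h2 := Nat.dvd_of_mod_eq_zero hr0'
      rcases Nat.lt_or_gt_of_ne hne with h3 | h3
      · have := Nat.le_of_dvd (by omega) (Nat.dvd_sub h1 h2)
        omega
      · have := Nat.le_of_dvd (by omega) (Nat.dvd_sub h2 h1)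
        omega
    · simpa using Finset.card_le_card (Finset.erase_subset _ _)
  obtain ⟨r, hr, hrc⟩ : ∃ r ∈ Finset.Icc 1 h, c r ≤ T.nodes.card / h := by
    by_contra! hcon
    have h1 := Finset.card_nsmul_le_sum (Finset.Icc 1 h) c (T.nodes.card / h + 1)
      fun r hr => hcon r hr
    rw [Nat.card_Icc, Nat.add_sub_cancel, smul_eq_mul] at h1
    exact absurd (h1.trans hsum) (not_le.2 (Nat.lt_mul_div_succ T.nodes.card hh))
  rw [Finset.mem_Icc] at hr
  refine ⟨r, hr.1, hr.2, le_trans ?_ (Nat.add_le_add_right hrc 1)⟩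
  have : (T.nodes.filter fun u => relDepth h r u.length = 0) ⊆
      insert [] ((T.nodes.erase []).filter fun u => relDepth h r u.length = 0) := by
    intro u hu
    rw [Finset.mem_filter] at hu
    rw [Finset.mem_insert, Finset.mem_filter, Finset.mem_erase]
    tauto
  exact (Finset.card_le_card this).trans (Finset.card_insert_le _ _)

/-! ### Positions of nodes in the layer-by-layer preorder -/

namespace OrdinalTree

variable (T : OrdinalTree) (h r : ℕ)

theorem take_mem {u : List ℕ} (hu : u ∈ T.nodes) (m : ℕ) : u.take m ∈ T.nodes := by
  induction u using List.reverseRecOn with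
  | nil => simpa using hu
  | append_singleton u i ih =>
    by_cases hm : m ≤ u.length
    · rw [List.take_append_of_le_length hm]
      exact ih (T.parent_mem u i hu)
    · rw [List.take_of_length_le (by simp; omega)]
      exact hu

theorem dropLast_mem {u : List ℕ} (hu : u ∈ T.nodes) : u.dropLast ∈ T.nodes := by
  rw [List.dropLast_eq_take]
  exact T.take_mem hu _

theorem length_lt_card {u : List ℕ} (hu : u ∈ T.nodes) : u.length < T.nodes.card := by
  have h1 : ((Finset.range (u.length + 1)).image fun m => u.take m) ⊆ T.nodes := by
    intro v hv
    obtain ⟨m, -, rfl⟩ := Finset.mem_image.1 hv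
    exact T.take_mem hu m
  have h2 := Finset.card_le_card h1
  rw [Finset.card_image_of_injOn, Finset.card_range] at h2
  · omega
  · intro m hm m' hm' he
    have := congrArg List.length he
    simp only [Finset.coe_range, Set.mem_Iio, List.length_take] at *
    omega

/-- The sorting key of a node: the nodes are sorted by layers, and within a layer in preorder. -/
def sortKey (u : List ℕ) : ℕ ×ₗ List ℕ := toLex (layerOfDepth h r u.length, u)

/-- The position (from `0`) of a node when the nodes are sorted by layers, and within a layer in
preorder. -/
def pos (u : List ℕ) : ℕ := (T.nodes.filter fun v => sortKey h r v < sortKey h r u).card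

/-- The number of nodes in the layers before layer `l`. -/
def layerStart (l : ℕ) : ℕ := (T.nodes.filter fun v => layerOfDepth h r v.length < l).card

open Classical in
/-- The node at position `i`, and the root if there is none. -/
noncomputable def nodeAt (i : ℕ) : List ℕ :=
  if hi : ∃ u ∈ T.nodes, T.pos h r u = i then hi.choose else []

/-- The depth, relative to the top level of its layer, of the node at position `i`. -/
noncomputable def relDepthAt (i : ℕ) : ℕ := relDepth h r (T.nodeAt h r i).length

variable {h r}

theorem sortKey_lt_iff {u v : List ℕ} : sortKey h r u < sortKey h r v ↔
    layerOfDepth h r u.length < layerOfDepth h r v.length ∨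
      layerOfDepth h r u.length = layerOfDepth h r v.length ∧ u < v := by
  rw [sortKey, sortKey, Prod.Lex.toLex_lt_toLex]

theorem sortKey_le_iff {u v : List ℕ} : sortKey h r u ≤ sortKey h r v ↔
    layerOfDepth h r u.length < layerOfDepth h r v.length ∨
      layerOfDepth h r u.length = layerOfDepth h r v.length ∧ u ≤ v := by
  rw [sortKey, sortKey, Prod.Lex.toLex_le_toLex]

theorem sortKey_injective : Function.Injective (sortKey h r) := fun u v huv => by
  have := toLex.injective huv
  rw [Prod.mk.injEq] at this
  exact this.2

theorem sortKey_mono_of_prefix {u v : List ℕ} (huv : u <+: v) : sortKey h r u ≤ sortKey h r v := by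
  rw [sortKey_le_iff]
  rcases (layerOfDepth_mono (h := h) (r := r) huv.length_le).lt_or_eq with h1 | h1
  · exact Or.inl h1
  · exact Or.inr ⟨h1, huv.le_lex⟩

variable {T}

theorem pos_lt_pos {u v : List ℕ} (hu : u ∈ T.nodes) (huv : sortKey h r u < sortKey h r v) :
    T.pos h r u < T.pos h r v := by
  refine Finset.card_lt_card (Finset.ssubset_iff_of_subset ?_ |>.2 ⟨u, ?_, ?_⟩)
  · intro w hw
    rw [Finset.mem_filter] at hw ⊢
    exact ⟨hw.1, hw.2.trans huv⟩
  · exact Finset.mem_filter.2 ⟨hu, huv⟩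
  · simp

theorem pos_le_pos_iff {u v : List ℕ} (hu : u ∈ T.nodes) (hv : v ∈ T.nodes) :
    T.pos h r u ≤ T.pos h r v ↔ sortKey h r u ≤ sortKey h r v := by
  constructor
  · intro h1
    by_contra! h2
    exact absurd (pos_lt_pos hv h2) (not_lt.2 h1)
  · intro h1
    rcases h1.lt_or_eq with h1 | h1
    · exact (pos_lt_pos hu h1).le
    · rw [sortKey_injective h1]

theorem pos_lt_pos_iff {u v : List ℕ} (hu : u ∈ T.nodes) (hv : v ∈ T.nodes) :
    T.pos h r u < T.pos h r v ↔ sortKey h r u < sortKey h r v := by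
  rw [← not_le, ← not_le, pos_le_pos_iff hv hu]

theorem pos_inj {u v : List ℕ} (hu : u ∈ T.nodes) (hv : v ∈ T.nodes)
    (huv : T.pos h r u = T.pos h r v) : u = v :=
  sortKey_injective (h := h) (r := r)
    (le_antisymm ((pos_le_pos_iff hu hv).1 huv.le) ((pos_le_pos_iff hv hu).1 huv.ge))

theorem pos_lt_card {u : List ℕ} (hu : u ∈ T.nodes) : T.pos h r u < T.nodes.card := by
  refine Finset.card_lt_card (Finset.ssubset_iff_of_subset (Finset.filter_subset _ _) |>.2
    ⟨u, hu, by simp⟩)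

theorem image_pos : T.nodes.image (T.pos h r) = Finset.range T.nodes.card := by
  refine Finset.eq_of_subset_of_card_le ?_ ?_
  · intro i hi
    obtain ⟨u, hu, rfl⟩ := Finset.mem_image.1 hi
    exact Finset.mem_range.2 (pos_lt_card hu)
  · rw [Finset.card_range, Finset.card_image_of_injOn]
    exact fun u hu v hv huv => pos_inj hu hv huv

theorem exists_pos_eq {i : ℕ} (hi : i < T.nodes.card) : ∃ u ∈ T.nodes, T.pos h r u = i := by
  rw [← Finset.mem_range, ← image_pos (h := h) (r := r)] at hi
  exact Finset.mem_image.1 hi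

theorem nodeAt_pos {u : List ℕ} (hu : u ∈ T.nodes) : T.nodeAt h r (T.pos h r u) = u := by
  have h1 : ∃ v ∈ T.nodes, T.pos h r v = T.pos h r u := ⟨u, hu, rfl⟩
  rw [nodeAt, dif_pos h1]
  exact pos_inj h1.choose_spec.1 hu h1.choose_spec.2

theorem nodeAt_of_card_le {i : ℕ} (hi : T.nodes.card ≤ i) : T.nodeAt h r i = [] := by
  rw [nodeAt, dif_neg]
  rintro ⟨u, hu, rfl⟩
  exact absurd (pos_lt_card hu) (not_lt.2 hi)

theorem relDepthAt_pos {u : List ℕ} (hu : u ∈ T.nodes) :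
    T.relDepthAt h r (T.pos h r u) = relDepth h r u.length := by
  rw [relDepthAt, nodeAt_pos hu]

theorem relDepthAt_lt (hh : 0 < h) (hr : r ≤ h) (i : ℕ) : T.relDepthAt h r i < h :=
  relDepth_lt hh hr _

theorem relDepthAt_of_card_le {i : ℕ} (hi : T.nodes.card ≤ i) : T.relDepthAt h r i = 0 := by
  rw [relDepthAt, nodeAt_of_card_le hi]
  exact Nat.le_zero.1 (relDepth_le 0)

theorem ident_eq {u : List ℕ} (hu : u ∈ T.nodes) :
    T.layerStart h r (layerOfDepth h r u.length) ≤ T.pos h r u ∧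
    T.ident h r u = (layerOfDepth h r u.length,
      T.pos h r u - T.layerStart h r (layerOfDepth h r u.length) + 1) := by
  have h1 : T.pos h r u = T.layerStart h r (layerOfDepth h r u.length) +
      (T.nodes.filter fun v =>
        layerOfDepth h r v.length = layerOfDepth h r u.length ∧ v < u).card := by
    rw [pos, layerStart, ← Finset.card_union_of_disjoint]
    · congr 1
      ext v
      simp only [Finset.mem_filter, Finset.mem_union, sortKey_lt_iff]
      tauto
    · rw [Finset.disjoint_filter]
      intro v _ h1 h2
      omega
  have h2 : (T.nodes.filter fun v =>
      layerOfDepth h r v.length = layerOfDepth h r u.length ∧ v ≤ u) =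
      insert u (T.nodes.filter fun v =>
        layerOfDepth h r v.length = layerOfDepth h r u.length ∧ v < u) := by
    ext v
    simp only [Finset.mem_filter, Finset.mem_insert]
    constructor
    · rintro ⟨h1, h2, h3⟩
      rcases h3.lt_or_eq with h3 | h3
      · exact Or.inr ⟨h1, h2, h3⟩
      · exact Or.inl h3
    · rintro (rfl | ⟨h1, h2, h3⟩)
      · exact ⟨hu, rfl, le_refl v⟩
      · exact ⟨h1, h2, le_of_lt h3⟩
  refine ⟨by omega, ?_⟩
  rw [ident, Prod.mk.injEq]
  refine ⟨rfl, ?_⟩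
  rw [h2, Finset.card_insert_of_notMem (by simp), h1]
  omega

theorem layerStart_mono : Monotone (T.layerStart h r) := fun l l' hl =>
  Finset.card_le_card fun v hv => by
    rw [Finset.mem_filter] at hv ⊢
    exact ⟨hv.1, hv.2.trans_le hl⟩

theorem layerStart_le (l : ℕ) : T.layerStart h r l ≤ T.nodes.card :=
  Finset.card_le_card (Finset.filter_subset _ _)

/-- The ancestor of `u` on a level of the layer of `u` is the last node up to `u` on that level. -/
theorem relDepth_lt_relDepthAt {a u : List ℕ} (hu : u ∈ T.nodes) (hau : a <+: u)
    (hl : layerOfDepth h r a.length = layerOfDepth h r u.length) {i : ℕ}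
    (h1 : T.pos h r a < i) (h2 : i ≤ T.pos h r u) :
    relDepth h r a.length < T.relDepthAt h r i := by
  have ha : a ∈ T.nodes := by
    rw [List.prefix_iff_eq_take.1 hau]
    exact T.take_mem hu _
  obtain ⟨v, hv, rfl⟩ := exists_pos_eq (h := h) (r := r) (lt_of_le_of_lt h2 (pos_lt_card hu))
  have h3 := sortKey_lt_iff.1 ((pos_lt_pos_iff ha hv).1 h1)
  have h4 := sortKey_le_iff.1 ((pos_le_pos_iff hv hu).1 h2)
  have h5 : layerOfDepth h r a.length = layerOfDepth h r v.length := by omega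
  have h6 : a < v := by
    rcases h3 with h3 | h3
    · omega
    · exact h3.2
  have h7 : v ≤ u := by
    rcases h4 with h4 | h4
    · omega
    · exact h4.2
  have h8 := hau.of_le_of_le (le_of_lt h6) h7
  rw [relDepthAt_pos hv, relDepth_add_of_layer_eq h8.length_le h5]
  have h9 : a.length ≠ v.length := fun h9 => absurd (h8.eq_of_length h9) (ne_of_lt h6)
  have := h8.length_le
  omega

theorem relDepthAt_zero : T.relDepthAt h r 0 = 0 := by
  have h0 : T.pos h r [] = 0 := by
    rw [pos, Finset.card_eq_zero, Finset.filter_eq_empty_iff]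
    intro v _
    exact not_lt.2 (sortKey_mono_of_prefix List.nil_prefix)
  have := relDepthAt_pos (h := h) (r := r) T.root_mem
  rw [h0] at this
  rw [this]
  exact Nat.le_zero.1 (relDepth_le 0)

theorem relDepthAt_succ_le (i : ℕ) : T.relDepthAt h r (i + 1) ≤ T.relDepthAt h r i + 1 := by
  by_cases hi : i + 1 < T.nodes.card
  · obtain ⟨u, hu, hui⟩ := exists_pos_eq (h := h) (r := r) hi
    by_cases h0 : relDepth h r u.length = 0
    · rw [← hui, relDepthAt_pos hu, h0]
      omega
    · have hlen : u.length - 1 + 1 = u.length := by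
        have := relDepth_le (h := h) (r := r) u.length
        omega
      have h1 : layerOfDepth h r u.dropLast.length = layerOfDepth h r u.length := by
        rw [List.length_dropLast]
        conv_rhs => rw [← hlen]
        exact relDepth_succ_of_ne_zero (by rwa [hlen])
      have h2 : relDepth h r u.length = relDepth h r u.dropLast.length + 1 := by
        rw [relDepth_add_of_layer_eq (List.dropLast_prefix u).length_le h1, List.length_dropLast]
        omega
      have h3 : T.pos h r u.dropLast < T.pos h r u := by
        refine pos_lt_pos (T.dropLast_mem hu) (lt_of_le_of_ne
          (sortKey_mono_of_prefix (List.dropLast_prefix u)) fun h3 => ?_)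
        rw [sortKey_injective h3] at h2
        omega
      rw [← hui, relDepthAt_pos hu, h2]
      rcases Nat.lt_or_eq_of_le (show T.pos h r u.dropLast ≤ i by omega) with h4 | h4
      · exact Nat.succ_le_succ
          (relDepth_lt_relDepthAt hu (List.dropLast_prefix u) h1 h4 (by omega)).le
      · rw [← h4, relDepthAt_pos (T.dropLast_mem hu)]
  · rw [relDepthAt_of_card_le (by omega)]
    omega

/-! ### The parents of the nodes on the top levels of layers -/

variable (T h r) in
/-- The number of nodes on top levels of layers before position `i`. -/
noncomputable def topRank (i : ℕ) : ℕ :=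
  Nat.count (fun i => T.relDepthAt h r i = 0) i

variable (T h r) in
/-- The position of the parent of the `k`-th node (from `0`) on a top level of a layer. The supremum
over all earlier such nodes makes monotonicity in `k` evident. -/
noncomputable def topParent (k : ℕ) : ℕ :=
  (T.nodes.filter fun u => relDepth h r u.length = 0 ∧ T.topRank h r (T.pos h r u) ≤ k).sup
    fun u => T.pos h r u.dropLast

theorem topParent_mono : Monotone (T.topParent h r) := fun k k' hk =>
  Finset.sup_mono fun v hv => by
    rw [Finset.mem_filter] at hv ⊢
    exact ⟨hv.1, hv.2.1, hv.2.2.trans hk⟩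

theorem topParent_le (k : ℕ) : T.topParent h r k ≤ T.nodes.card :=
  Finset.sup_le fun _ hu => (pos_lt_card (T.dropLast_mem (Finset.mem_filter.1 hu).1)).le

/-- Parents of nodes on top levels of layers are in the same order as these nodes. -/
theorem pos_dropLast_le {u v : List ℕ} (hu : u ∈ T.nodes) (hv : v ∈ T.nodes)
    (hu0 : relDepth h r u.length = 0) (hv0 : relDepth h r v.length = 0)
    (huv : T.pos h r u ≤ T.pos h r v) : T.pos h r u.dropLast ≤ T.pos h r v.dropLast := by
  rw [pos_le_pos_iff (T.dropLast_mem hu) (T.dropLast_mem hv)]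
  rcases eq_or_ne u [] with rfl | hu1
  · exact sortKey_mono_of_prefix List.nil_prefix
  have hul : u.length - 1 + 1 = u.length := by
    have := List.length_pos_iff.2 hu1
    omega
  have h1 := layerOfDepth_succ_of_eq_zero (h := h) (r := r) (d := u.length - 1) (by rwa [hul])
  have h2 := sortKey_le_iff.1 ((pos_le_pos_iff hu hv).1 huv)
  have hp := layerOfDepth_pos (h := h) (r := r) (u.length - 1)
  rcases eq_or_ne v [] with rfl | hv1
  · exfalso
    have h3 := sortKey_mono_of_prefix (h := h) (r := r) (u := []) (v := u) List.nil_prefix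
    exact hu1 (sortKey_injective (le_antisymm ((pos_le_pos_iff hu hv).1 huv) h3))
  have hvl : v.length - 1 + 1 = v.length := by
    have := List.length_pos_iff.2 hv1
    omega
  have h3 := layerOfDepth_succ_of_eq_zero (h := h) (r := r) (d := v.length - 1) (by rwa [hvl])
  rw [hul] at h1
  rw [hvl] at h3
  rw [sortKey_le_iff, List.length_dropLast, List.length_dropLast]
  rcases h2 with h2 | ⟨h2, h4⟩
  · left
    omega
  · right
    refine ⟨by omega, List.dropLast_le_dropLast ?_ h4⟩
    rcases Nat.le_total u.length v.length with h5 | h5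
    · have := relDepth_add_of_layer_eq h5 h2
      omega
    · have := relDepth_add_of_layer_eq h5 h2.symm
      omega

theorem topParent_topRank {u : List ℕ} (hu : u ∈ T.nodes) (hu0 : relDepth h r u.length = 0) :
    T.topParent h r (T.topRank h r (T.pos h r u)) = T.pos h r u.dropLast := by
  refine le_antisymm (Finset.sup_le fun v hv => ?_)
    (Finset.le_sup (f := fun u => T.pos h r u.dropLast) (Finset.mem_filter.2 ⟨hu, hu0, le_rfl⟩))
  obtain ⟨hv, hv0, hvu⟩ := Finset.mem_filter.1 hv
  refine pos_dropLast_le hv hu hv0 hu0 ?_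
  by_contra! h1
  exact absurd (Nat.count_strict_mono (p := fun i => T.relDepthAt h r i = 0)
    (by rw [relDepthAt_pos hu, hu0]) h1) (not_lt.2 hvu)

theorem topRank_card : T.topRank h r T.nodes.card =
    (T.nodes.filter fun u => relDepth h r u.length = 0).card := by
  rw [topRank, Nat.count_eq_card_filter_range, ← image_pos (h := h) (r := r), Finset.filter_image,
    Finset.card_image_of_injOn fun u hu v hv huv =>
      pos_inj (Finset.mem_filter.1 hu).1 (Finset.mem_filter.1 hv).1 huv]
  congr 1
  refine Finset.filter_congr fun u hu => ?_
  rw [relDepthAt_pos hu]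

end OrdinalTree

/-! ### Paths to the root -/

theorem rootPath_eq_map_take (u : List ℕ) :
    rootPath u = (List.range (u.length + 1)).map fun i => u.take (u.length - i) := by
  refine List.ext_getElem (by simp [rootPath]) fun i h1 h2 => ?_
  simp only [rootPath, List.getElem_reverse, List.getElem_inits, List.length_inits,
    List.getElem_map, List.getElem_range]
  congr 1

theorem rootPath_split (u : List ℕ) {k : ℕ} (hk : k < u.length) :
    rootPath u = ((List.range (k + 1)).map fun i => u.take (u.length - i)) ++
      rootPath (u.take (u.length - k - 1)) := by
  have hl : (u.take (u.length - k - 1)).length = u.length - k - 1 := by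
    rw [List.length_take]
    omega
  rw [rootPath_eq_map_take (u.take _), hl, rootPath_eq_map_take u,
    show u.length + 1 = (k + 1) + (u.length - k - 1 + 1) by omega, List.range_add,
    List.map_append, List.map_map]
  congr 1
  refine List.map_congr_left fun i _ => ?_
  rw [List.take_take, Function.comp_apply]
  congr 1
  omega

/-! ### The disk layout -/

/-- The parameters of the representation of a tree with `N` nodes and `q`-bit keys in layers of
height `h`. The positions of nodes are cut into blocks of `A` positions, and the blocks into
superblocks of `S` blocks. The number of bits of a position is `b`, and that of a position within a
superblock is `X`. The starting positions of layers (at most `M`) and the positions of the parents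
of nodes on top levels of layers (at most `M`) form a monotone sequence, stored in `g` groups of
`s` terms. -/
structure Layout where
  (N h q A S X b s g M : ℕ)

/-- The data to be represented: the relative depth `depth i` and the key `key i` of the node at
position `i`, and a monotone sequence. -/
structure Contents where
  (depth key seq : ℕ → ℕ)

/-- The last position before `n` with relative depth `k`, and `0` if there is none. -/
def Contents.last (c : Contents) (n k : ℕ) : ℕ :=
  Nat.findGreatest (fun i => i < n ∧ c.depth i = k) n

/-- The number of positions before `n` with relative depth `0`. -/
def Contents.topRank (c : Contents) (n : ℕ) : ℕ := Nat.count (fun i => c.depth i = 0) n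

theorem Contents.last_eq (c : Contents) {n k x : ℕ} (hx : x < n) (hk : c.depth x = k)
    (h : ∀ i, x < i → i < n → c.depth i ≠ k) : c.last n k = x := by
  refine (Nat.findGreatest_eq_iff).2 ⟨hx.le, fun _ => ⟨hx, hk⟩, fun i h1 _ h2 => ?_⟩
  exact h i h1 h2.1 h2.2

namespace Layout

variable (L : Layout) (c : Contents)

/-- The bit vector that represents the relative depths: the bits at the positions
`2 * i - depth i` are set. -/
def treeBits : List Bool :=
  List.ofFn fun x : Fin (2 * L.N) => decide (∃ i < L.N, (x : ℕ) = 2 * i - c.depth i)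

/-- The keys. -/
def keyBits : List Bool := (List.range L.N).flatMap fun i => bitsOf L.q (c.key i)

/-- For each block, the relative depth of its first position and the number of earlier positions
with relative depth `0`. -/
def headBits : List Bool := (List.range (L.N / L.A + 1)).flatMap fun j =>
  bitsOf L.b (c.depth (j * L.A)) ++ bitsOf L.b (c.topRank (j * L.A))

/-- The code, in the record of block `j`, for the last position before this block with relative
depth `k`: its offset, increased by one, within the superblock of block `j`, or `0` if it lies
before this superblock. -/
def nearCode (j k : ℕ) : ℕ :=
  if c.last (j * L.A) k < j / L.S * (L.A * L.S) then 0
  else c.last (j * L.A) k - j / L.S * (L.A * L.S) + 1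

/-- One entry of a block record: the code of a position, and its key. -/
def nearEntry (j k : ℕ) : List Bool :=
  bitsOf L.X (L.nearCode c j k) ++ bitsOf L.q (c.key (c.last (j * L.A) k))

/-- The record of block `j`: for each relative depth, the last earlier position with this relative
depth. -/
def nearRecord (j : ℕ) : List Bool := (List.range L.h).flatMap (L.nearEntry c j)

/-- The records of all blocks but the first. -/
def nearBits : List Bool := (List.range (L.N / L.A)).flatMap fun j => L.nearRecord c (j + 1)

/-- The record of superblock `t`: for each relative depth, the last earlier position with this
relative depth. -/
def farRecord (t : ℕ) : List Bool :=
  (List.range L.h).flatMap fun k => bitsOf L.b (c.last (t * (L.A * L.S)) k)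

/-- The records of all superblocks but the first. -/
def farBits : List Bool :=
  (List.range (L.N / (L.A * L.S))).flatMap fun t => L.farRecord c (t + 1)

/-- The disk content. -/
def disk : List Bool :=
  L.treeBits c ++ (L.keyBits c ++ (L.headBits c ++ (L.nearBits c ++ (L.farBits c ++
    monoBits c.seq L.s L.b L.g))))

/-- The starting position of the keys. -/
def keyStart : ℕ := 2 * L.N
/-- The starting position of `headBits`. -/
def headStart : ℕ := L.keyStart + L.N * L.q
/-- The starting position of the block records. -/
def nearStart : ℕ := L.headStart + (L.N / L.A + 1) * (2 * L.b)
/-- The starting position of the superblock records. -/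
def farStart : ℕ := L.nearStart + L.N / L.A * (L.h * (L.X + L.q))
/-- The starting position of the monotone sequence. -/
def monoStart : ℕ := L.farStart + L.N / (L.A * L.S) * (L.h * L.b)

theorem length_treeBits : (L.treeBits c).length = 2 * L.N := by simp [treeBits]

theorem length_keyBits : (L.keyBits c).length = L.N * L.q :=
  length_flatMap_range_const (fun _ => length_bitsOf _ _) _

theorem length_headBits : (L.headBits c).length = (L.N / L.A + 1) * (2 * L.b) :=
  length_flatMap_range_const (fun _ => by simp; ring) _

theorem length_nearEntry (j k : ℕ) : (L.nearEntry c j k).length = L.X + L.q := by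
  simp [nearEntry]

theorem length_nearRecord (j : ℕ) : (L.nearRecord c j).length = L.h * (L.X + L.q) :=
  length_flatMap_range_const (L.length_nearEntry c j) _

theorem length_nearBits : (L.nearBits c).length = L.N / L.A * (L.h * (L.X + L.q)) :=
  length_flatMap_range_const (fun _ => L.length_nearRecord c _) _

theorem length_farRecord (t : ℕ) : (L.farRecord c t).length = L.h * L.b :=
  length_flatMap_range_const (fun _ => length_bitsOf _ _) _

theorem length_farBits : (L.farBits c).length = L.N / (L.A * L.S) * (L.h * L.b) :=
  length_flatMap_range_const (fun _ => L.length_farRecord c _) _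

theorem length_disk : (L.disk c).length =
    L.monoStart + (monoBits c.seq L.s L.b L.g).length := by
  simp only [disk, List.length_append, length_treeBits, length_keyBits, length_headBits,
    length_nearBits, length_farBits, monoStart, farStart, nearStart, headStart, keyStart]
  ring

theorem holds_disk : Holds (fun i => (L.disk c).getD i false) 0 (L.treeBits c) ∧
    Holds (fun i => (L.disk c).getD i false) L.keyStart (L.keyBits c) ∧
    Holds (fun i => (L.disk c).getD i false) L.headStart (L.headBits c) ∧
    Holds (fun i => (L.disk c).getD i false) L.nearStart (L.nearBits c) ∧
    Holds (fun i => (L.disk c).getD i false) L.farStart (L.farBits c) ∧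
    Holds (fun i => (L.disk c).getD i false) L.monoStart (monoBits c.seq L.s L.b L.g) := by
  have h0 := holds_getD (L.disk c)
  have h1 := h0.right
  rw [length_treeBits, Nat.zero_add] at h1
  have h2 := h1.right
  rw [length_keyBits] at h2
  have h3 := h2.right
  rw [length_headBits] at h3
  have h4 := h3.right
  rw [length_nearBits] at h4
  have h5 := h4.right
  rw [length_farBits] at h5
  exact ⟨h0.left, h1.left, h2.left, h3.left, h4.left, h5⟩

/-- The requirements on the parameters. -/
structure Valid : Prop where
  A_pos : 0 < L.A
  S_pos : 0 < L.S
  s_pos : 0 < L.s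
  near : L.A * L.S < 2 ^ L.X
  far : 2 * L.N < 2 ^ L.b
  ptr : L.s * (L.g * L.b) < 2 ^ L.b

/-- The requirements on the data. -/
structure Fits : Prop where
  depth_zero : c.depth 0 = 0
  depth_succ : ∀ i, c.depth (i + 1) ≤ c.depth i + 1
  depth_lt : ∀ i, c.depth i < L.h
  key_lt : ∀ i, c.key i < 2 ^ L.q
  seq_mono : Monotone c.seq
  seq_le : ∀ i, c.seq i ≤ 2 * L.N

variable {L c}

theorem nearCode_lt (hL : L.Valid) (j k : ℕ) : L.nearCode c j k < 2 ^ L.X := by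
  refine lt_of_le_of_lt ?_ hL.near
  unfold nearCode
  have hAS : 0 < L.A * L.S := Nat.mul_pos hL.A_pos hL.S_pos
  split_ifs with h1
  · omega
  · by_cases h2 : c.last (j * L.A) k = 0
    · omega
    have h3 : c.last (j * L.A) k < j * L.A :=
      (Nat.findGreatest_of_ne_zero (P := fun i => i < j * L.A ∧ c.depth i = k) rfl h2).1
    have h4 : j * L.A ≤ j / L.S * (L.A * L.S) + L.A * L.S := by
      have h5 : j ≤ (j / L.S + 1) * L.S := (Nat.lt_mul_of_div_lt (Nat.lt_succ_self _) hL.S_pos).le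
      calc j * L.A ≤ (j / L.S + 1) * L.S * L.A := Nat.mul_le_mul_right _ h5
        _ = _ := by ring
    omega

theorem Fits.depth_le (hc : L.Fits c) (i : ℕ) : c.depth i ≤ i := by
  induction i with
  | zero => exact hc.depth_zero.le
  | succ i ih => exact (hc.depth_succ i).trans (by omega)

/-- The positions of the set bits of `treeBits` are in the order of the nodes. -/
theorem Fits.mark_strictMono (hc : L.Fits c) : StrictMono fun i => 2 * i - c.depth i := by
  refine strictMono_nat_of_lt_succ fun i => ?_
  have := hc.depth_le i
  have := hc.depth_succ i
  omega

/-- The relative depth at position `i`, decoded from a view `v` of `treeBits`: the set bit for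
position `i` is found by counting from the set bit for the position `i₀`, which is bit `x₀`. -/
noncomputable def decodeDepth (v : ℕ → Bool) (i₀ x₀ i : ℕ) : ℕ :=
  2 * i - (x₀ + Nat.nth (fun t => v (x₀ + t) = true) (i - i₀))

theorem decodeDepth_eq (hc : L.Fits c) {v : ℕ → Bool} {i₀ i : ℕ} (h0 : i₀ ≤ i) (hi : i < L.N)
    (hv : ∀ x, 2 * i₀ - c.depth i₀ ≤ x → x ≤ 2 * i - c.depth i →
      v x = (L.disk c).getD x false) :
    decodeDepth v i₀ (2 * i₀ - c.depth i₀) i = c.depth i := by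
  have hm := hc.mark_strictMono
  have hbit : ∀ x, 2 * i₀ - c.depth i₀ ≤ x → x ≤ 2 * i - c.depth i →
      (v x = true ↔ ∃ i < L.N, x = 2 * i - c.depth i) := by
    intro x h1 h2
    have h3 : x < 2 * L.N := by omega
    have h4 := (L.holds_disk c).1 x (by rwa [length_treeBits])
    simp only [Nat.zero_add] at h4
    rw [hv x h1 h2, h4, List.getD_eq_getElem _ _ (by rwa [length_treeBits])]
    simp [treeBits]
  set x₀ := 2 * i₀ - c.depth i₀ with hx₀
  have hle : x₀ ≤ 2 * i - c.depth i := hm.monotone h0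
  have hcount : Nat.count (fun t => v (x₀ + t) = true) (2 * i - c.depth i - x₀) = i - i₀ := by
    rw [Nat.count_eq_card_filter_range]
    have : (Finset.range (2 * i - c.depth i - x₀)).filter (fun t => v (x₀ + t) = true) =
        (Finset.Ico i₀ i).image fun i' => 2 * i' - c.depth i' - x₀ := by
      ext t
      rw [Finset.mem_filter, Finset.mem_range, Finset.mem_image]
      constructor
      · rintro ⟨h1, h2⟩
        obtain ⟨i', h3, h4⟩ := (hbit _ (by omega) (by omega)).1 h2
        refine ⟨i', Finset.mem_Ico.2 ⟨?_, ?_⟩, by omega⟩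
        · exact hm.le_iff_le.1 (show x₀ ≤ 2 * i' - c.depth i' by omega)
        · exact hm.lt_iff_lt.1 (show 2 * i' - c.depth i' < 2 * i - c.depth i by omega)
      · rintro ⟨i', h1, rfl⟩
        rw [Finset.mem_Ico] at h1
        have h2 : x₀ ≤ 2 * i' - c.depth i' := hm.monotone h1.1
        have h3 : 2 * i' - c.depth i' < 2 * i - c.depth i := hm h1.2
        refine ⟨by omega, (hbit _ (by omega) (by omega)).2 ⟨i', by omega, by omega⟩⟩
    rw [this, Finset.card_image_of_injOn, Nat.card_Ico]
    intro i' h1 i'' h2 h3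
    simp only [Finset.coe_Ico, Set.mem_Ico] at h1 h2 h3
    have h4 : x₀ ≤ 2 * i' - c.depth i' := hm.monotone h1.1
    have h5 : x₀ ≤ 2 * i'' - c.depth i'' := hm.monotone h2.1
    exact hm.injective (show 2 * i' - c.depth i' = 2 * i'' - c.depth i'' by omega)
  have hnth := Nat.nth_count (p := fun t => v (x₀ + t) = true) (n := 2 * i - c.depth i - x₀)
    ((hbit _ (by omega) (by omega)).2 ⟨i, hi, by omega⟩)
  rw [hcount] at hnth
  rw [decodeDepth, hnth]
  have := hc.depth_le i
  omega

end Layout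

/-! ### One layer of a path -/

namespace Layout

variable (L : Layout) (c : Contents)

/-- Position and key of the ancestor at relative depth `k`, in its layer, of the node at position
`i`, where `j` is the block of `i`. The views `vt`, `vk`, `vn`, `vf` have to cover, respectively, the
part of the tree bits that represents block `j` (starting at bit `x₀`), the keys of block `j`, the
record of block `j`, and the record of its superblock. -/
noncomputable def ancestor (vt vk vn vf : ℕ → Bool) (j x₀ i k : ℕ) : ℕ × ℕ :=
  let x := Nat.findGreatest (fun x => j * L.A ≤ x ∧ decodeDepth vt (j * L.A) x₀ x = k) i
  let y := L.nearStart + (j - 1) * (L.h * (L.X + L.q)) + k * (L.X + L.q)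
  if j * L.A ≤ x ∧ decodeDepth vt (j * L.A) x₀ x = k then
    (x, natAt vk (L.keyStart + x * L.q) L.q)
  else
    (if natAt vn y L.X = 0 then
      natAt vf (L.farStart + (j / L.S - 1) * (L.h * L.b) + k * L.b) L.b
    else j / L.S * (L.A * L.S) + natAt vn y L.X - 1, natAt vn (y + L.X) L.q)

variable {L c}

theorem ancestor_eq (hL : L.Valid) (hc : L.Fits c) {vt vk vn vf : ℕ → Bool} {i j k x : ℕ}
    (hi : i < L.N) (hj : j = i / L.A)
    (hvt : ∀ y, 2 * (j * L.A) - c.depth (j * L.A) ≤ y →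
      y < 2 * (j * L.A) - c.depth (j * L.A) + (2 * L.A + L.h) → vt y = (L.disk c).getD y false)
    (hvk : ∀ y, L.keyStart + j * L.A * L.q ≤ y →
      y < L.keyStart + j * L.A * L.q + L.A * L.q → vk y = (L.disk c).getD y false)
    (hvn : ∀ y, L.nearStart + (j - 1) * (L.h * (L.X + L.q)) ≤ y →
      y < L.nearStart + (j - 1) * (L.h * (L.X + L.q)) + L.h * (L.X + L.q) →
      vn y = (L.disk c).getD y false)
    (hvf : ∀ y, L.farStart + (j / L.S - 1) * (L.h * L.b) ≤ y →
      y < L.farStart + (j / L.S - 1) * (L.h * L.b) + L.h * L.b → vf y = (L.disk c).getD y false)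
    (hx : x ≤ i) (hk : c.depth x = k) (hxi : ∀ y, x < y → y ≤ i → c.depth y ≠ k) :
    L.ancestor vt vk vn vf j (2 * (j * L.A) - c.depth (j * L.A)) i k = (x, c.key x) := by
  obtain ⟨-, hkey, -, hnear, hfar, -⟩ := L.holds_disk c
  have hji : j * L.A ≤ i := hj ▸ Nat.div_mul_le_self i L.A
  have hij : i < j * L.A + L.A := by
    have := Nat.lt_div_mul_add (a := i) hL.A_pos
    rwa [← hj] at this
  have hkh : k < L.h := hk ▸ hc.depth_lt x
  have hdec : ∀ y, j * L.A ≤ y → y ≤ i →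
      decodeDepth vt (j * L.A) (2 * (j * L.A) - c.depth (j * L.A)) y = c.depth y := by
    intro y h1 h2
    refine decodeDepth_eq hc h1 (by omega) fun z h3 h4 => hvt z h3 ?_
    have := hc.depth_lt (j * L.A)
    have := hc.depth_le (j * L.A)
    omega
  by_cases hjx : j * L.A ≤ x
  · have hfg : Nat.findGreatest (fun x => j * L.A ≤ x ∧
        decodeDepth vt (j * L.A) (2 * (j * L.A) - c.depth (j * L.A)) x = k) i = x := by
      refine Nat.findGreatest_eq_iff.2 ⟨hx, fun _ => ⟨hjx, by rw [hdec x hjx hx, hk]⟩, ?_⟩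
      rintro y h1 h2 ⟨h3, h4⟩
      rw [hdec y h3 h2] at h4
      exact hxi y h1 h2 h4
    have h1 : natAt vk (L.keyStart + x * L.q) L.q = c.key x := by
      rw [← natAt_eq_of_holds (hkey.flatMap_const (fun _ => length_bitsOf _ _)
        (show x < L.N by omega)) (hc.key_lt x)]
      have h2 := Nat.mul_le_mul_right L.q hjx
      have h3 := Nat.mul_le_mul_right L.q (show x + 1 ≤ j * L.A + L.A by omega)
      rw [Nat.add_mul, Nat.add_mul, Nat.one_mul] at h3
      exact natAt_congr fun y h4 h5 => hvk y (by omega) (by omega)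
    unfold ancestor
    simp only [hfg]
    rw [if_pos ⟨hjx, by rw [hdec x hjx hx, hk]⟩, h1]
  · have hfg : ¬ (j * L.A ≤ Nat.findGreatest (fun x => j * L.A ≤ x ∧
        decodeDepth vt (j * L.A) (2 * (j * L.A) - c.depth (j * L.A)) x = k) i ∧
        decodeDepth vt (j * L.A) (2 * (j * L.A) - c.depth (j * L.A)) (Nat.findGreatest (fun x =>
        j * L.A ≤ x ∧ decodeDepth vt (j * L.A) (2 * (j * L.A) - c.depth (j * L.A)) x = k) i) =
        k) := by
      rintro ⟨h1, h2⟩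
      have h3 := Nat.findGreatest_le (P := fun x => j * L.A ≤ x ∧
        decodeDepth vt (j * L.A) (2 * (j * L.A) - c.depth (j * L.A)) x = k) i
      rw [hdec _ h1 h3] at h2
      exact hxi _ (by omega) h3 h2
    have hlast : c.last (j * L.A) k = x := c.last_eq (by omega) hk fun y h1 h2 =>
      hxi y h1 (by omega)
    have hj0 : 0 < j := by
      rcases Nat.eq_zero_or_pos j with rfl | h0
      · omega
      · exact h0
    have hjN : j - 1 < L.N / L.A := by
      have := Nat.div_le_div_right (c := L.A) hi.le
      omega
    have hent := (hnear.flatMap_const (fun _ => L.length_nearRecord c _) hjN).flatMap_const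
      (L.length_nearEntry c _) hkh
    rw [Nat.sub_add_cancel hj0] at hent
    have hcode := natAt_eq_of_holds hent.left (nearCode_lt hL j k)
    have hkey' := natAt_eq_of_holds hent.right (hc.key_lt _)
    rw [length_bitsOf, hlast] at hkey'
    have hwin := Nat.mul_le_mul_right (L.X + L.q) (Nat.succ_le_of_lt hkh)
    rw [Nat.succ_mul] at hwin
    have e1 : natAt vn (L.nearStart + (j - 1) * (L.h * (L.X + L.q)) + k * (L.X + L.q)) L.X =
        L.nearCode c j k := by
      rw [← hcode]
      exact natAt_congr fun y h4 h5 => hvn y (by omega) (by omega)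
    have e2 : natAt vn (L.nearStart + (j - 1) * (L.h * (L.X + L.q)) + k * (L.X + L.q) + L.X) L.q =
        c.key x := by
      rw [← hkey']
      exact natAt_congr fun y h4 h5 => hvn y (by omega) (by omega)
    unfold ancestor
    simp only
    rw [if_neg hfg, e1, e2, Prod.mk.injEq]
    refine ⟨?_, rfl⟩
    unfold nearCode
    rw [hlast]
    by_cases hfarx : x < j / L.S * (L.A * L.S)
    · rw [if_pos hfarx, if_pos rfl]
      have ht0 : 0 < j / L.S := by
        rcases Nat.eq_zero_or_pos (j / L.S) with h0 | h0
        · rw [h0] at hfarx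
          omega
        · exact h0
      have hle : j / L.S * (L.A * L.S) ≤ j * L.A := by
        calc j / L.S * (L.A * L.S) = j / L.S * L.S * L.A := by ring
          _ ≤ j * L.A := Nat.mul_le_mul_right _ (Nat.div_mul_le_self j L.S)
      have htN : j / L.S - 1 < L.N / (L.A * L.S) := by
        have : j / L.S ≤ L.N / (L.A * L.S) := by
          rw [Nat.le_div_iff_mul_le (Nat.mul_pos hL.A_pos hL.S_pos)]
          omega
        omega
      have hfe := (hfar.flatMap_const (fun _ => L.length_farRecord c _) htN).flatMap_const
        (fun _ => length_bitsOf _ _) hkh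
      rw [Nat.sub_add_cancel ht0] at hfe
      have hlast' : c.last (j / L.S * (L.A * L.S)) k = x := c.last_eq hfarx hk fun y h1 h2 =>
        hxi y h1 (by omega)
      rw [hlast'] at hfe
      have hfar' := natAt_eq_of_holds hfe (show x < 2 ^ L.b by have := hL.far; omega)
      have hwin' := Nat.mul_le_mul_right L.b (Nat.succ_le_of_lt hkh)
      rw [Nat.succ_mul] at hwin'
      rw [← hfar']
      exact natAt_congr fun y h4 h5 => hvf y (by omega) (by omega)
    · rw [if_neg hfarx, if_neg (by omega)]
      omega

/-- Given the numbers of earlier tops at the beginning of a block, the rank of the last top up to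
position `i`. -/
theorem topRank_eq (hc : L.Fits c) {vt : ℕ → Bool} {i i₀ x : ℕ} (hi : i < L.N) (hi₀ : i₀ ≤ i)
    (hvt : ∀ y, 2 * i₀ - c.depth i₀ ≤ y → y ≤ 2 * i - c.depth i →
      vt y = (L.disk c).getD y false)
    (hx : x ≤ i) (hk : c.depth x = 0) (hxi : ∀ y, x < y → y ≤ i → c.depth y ≠ 0) :
    c.topRank i₀ + ((Finset.Icc i₀ i).filter fun y =>
      decodeDepth vt i₀ (2 * i₀ - c.depth i₀) y = 0).card - 1 = c.topRank x := by
  have h1 : c.topRank (i + 1) = c.topRank x + 1 := by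
    have : c.topRank (i + 1) = c.topRank (x + 1) := by
      unfold Contents.topRank
      rw [Nat.count_eq_card_filter_range, Nat.count_eq_card_filter_range]
      congr 1
      ext y
      simp only [Finset.mem_filter, Finset.mem_range]
      constructor
      · rintro ⟨h1, h2⟩
        refine ⟨?_, h2⟩
        by_contra! h3
        exact hxi y (by omega) (by omega) h2
      · rintro ⟨h1, h2⟩
        exact ⟨by omega, h2⟩
    rw [this, Contents.topRank, Nat.count_succ, if_pos hk, Contents.topRank]
  have h2 : c.topRank (i + 1) = c.topRank i₀ + ((Finset.Icc i₀ i).filter fun y =>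
      decodeDepth vt i₀ (2 * i₀ - c.depth i₀) y = 0).card := by
    unfold Contents.topRank
    rw [Nat.count_eq_card_filter_range, Nat.count_eq_card_filter_range,
      ← Finset.card_union_of_disjoint]
    · congr 1
      ext y
      simp only [Finset.mem_filter, Finset.mem_range, Finset.mem_union, Finset.mem_Icc]
      have hd : i₀ ≤ y → y ≤ i → decodeDepth vt i₀ (2 * i₀ - c.depth i₀) y = c.depth y :=
        fun h1 h2 => decodeDepth_eq hc h1 (by omega) fun z h3 h4 => hvt z h3
          (h4.trans (hc.mark_strictMono.monotone h2))
      constructor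
      · rintro ⟨h1, h2⟩
        by_cases h3 : y < i₀
        · exact Or.inl ⟨h3, h2⟩
        · exact Or.inr ⟨⟨by omega, by omega⟩, by rw [hd (by omega) (by omega), h2]⟩
      · rintro (⟨h1, h2⟩ | ⟨⟨h1, h2⟩, h3⟩)
        · exact ⟨by omega, h2⟩
        · exact ⟨by omega, by rw [← hd h1 h2, h3]⟩
    · rw [Finset.disjoint_left]
      intro y h1 h2
      simp only [Finset.mem_filter, Finset.mem_range, Finset.mem_Icc] at h1 h2
      omega
  omega

open BlockReader

variable (L) in
/-- The state of the query algorithm at the beginning of a round: the identifier of a node. -/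
abbrev State : Type := Fin (L.N + 2) × Fin (L.N + 2)

variable (L) in
/-- The state for an identifier. -/
def toState (x : ℕ × ℕ) : L.State := (Fin.ofNat _ x.1, Fin.ofNat _ x.2)

variable (L) in
/-- The part of the query algorithm for one layer: report the path from the current node to its
ancestor on the top level of its layer, and proceed to the parent of the latter. -/
noncomputable def round {O : Type} {β : ℕ} (hβ : 0 < β) (out : ℕ × ℕ → BitVec L.q → O)
    (s : L.State) : BlockReader β (List O × Option L.State) :=
  (readMono hβ L.s L.b L.g L.monoStart s.1).bind fun st =>
  let i := st + s.2 - 1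
  let j := i / L.A
  let y := L.headStart + j * (2 * L.b)
  (readRange hβ y (2 * L.b)).bind fun vh =>
  let x₀ := 2 * (j * L.A) - natAt vh y L.b
  (readRange hβ x₀ (2 * L.A + L.h)).bind fun vt =>
  (readRange hβ (L.keyStart + j * L.A * L.q) (L.A * L.q)).bind fun vk =>
  (readRange hβ (L.nearStart + (j - 1) * (L.h * (L.X + L.q))) (L.h * (L.X + L.q))).bind fun vn =>
  (readRange hβ (L.farStart + (j / L.S - 1) * (L.h * L.b)) (L.h * L.b)).bind fun vf =>
  let k := decodeDepth vt (j * L.A) x₀ i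
  let o := (List.range (k + 1)).map fun t =>
    let a := L.ancestor vt vk vn vf j x₀ i (k - t)
    out (s.1, a.1 - st + 1) (BitVec.ofNat L.q a.2)
  if (s.1 : ℕ) ≤ 1 then done (o, none) else
  (readMono hβ L.s L.b L.g L.monoStart (L.M + (natAt vh (y + L.b) L.b +
    ((Finset.Icc (j * L.A) i).filter fun y => decodeDepth vt (j * L.A) x₀ y = 0).card - 1))).bind
    fun par =>
  (readMono hβ L.s L.b L.g L.monoStart (s.1 - 1)).bind fun st' =>
  done (o, some (L.toState (s.1 - 1, par - L.N - st' + 1)))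

variable (L) in
/-- A bound on the number of blocks of `β` bits read for one layer of a path. -/
def roundCost (β : ℕ) : ℕ :=
  3 * (3 * L.b / β + L.b / β) + 2 * L.b / β + (2 * L.A + L.h) / β + L.A * L.q / β +
    L.h * (L.X + L.q) / β + L.h * L.b / β + 22

theorem depthLE_round {O : Type} {β : ℕ} (hβ : 0 < β) (out : ℕ × ℕ → BitVec L.q → O)
    (s : L.State) : (L.round hβ out s).DepthLE (L.roundCost β) := by
  have hm := fun i => depthLE_readMono hβ L.s L.b L.g L.monoStart i
  unfold round
  refine DepthLE.mono ((hm _).bind fun st => (depthLE_readRange _ _ _).bind fun vh =>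
    (depthLE_readRange _ _ _).bind fun vt => (depthLE_readRange _ _ _).bind fun vk =>
    (depthLE_readRange _ _ _).bind fun vn => (depthLE_readRange _ _ _).bind
    (n := 2 * (3 * L.b / β + 2 + (L.b / β + 2))) fun vf => ?_) ?_
  · simp only
    split_ifs
    · trivial
    · refine DepthLE.mono ((hm _).bind fun par => (hm _).bind (n := 0) fun st' => ?_) ?_
      · trivial
      · omega
  · unfold roundCost
    omega

end Layout

/-! ### The path query -/

namespace OrdinalTree

/-- The data represented for a tree with keys. The monotone sequence consists of the starting
positions of the layers and, shifted by the number of nodes, the positions of the parents of the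
nodes on top levels of layers. -/
noncomputable def contents (T : OrdinalTree) (h r M : ℕ) {q : ℕ} (key : List ℕ → BitVec q) :
    Contents where
  depth := T.relDepthAt h r
  key i := (key (T.nodeAt h r i)).toNat
  seq i := if i < M then T.layerStart h r i else T.nodes.card + T.topParent h r (i - M)

variable {T : OrdinalTree} {L : Layout} {r : ℕ}

theorem fits_contents (hh : 0 < L.h) (hr : r ≤ L.h) (hN : T.nodes.card = L.N)
    (key : List ℕ → BitVec L.q) : L.Fits (T.contents L.h r L.M key) where
  depth_zero := relDepthAt_zero
  depth_succ := relDepthAt_succ_le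
  depth_lt := relDepthAt_lt hh hr
  key_lt _ := BitVec.isLt _
  seq_mono := by
    intro i i' hi
    simp only [contents]
    split_ifs
    · exact layerStart_mono hi
    · exact (layerStart_le i).trans (Nat.le_add_right _ _)
    · omega
    · exact Nat.add_le_add_left (topParent_mono (Nat.sub_le_sub_right hi _)) _
  seq_le i := by
    have h1 := T.layerStart_le (h := L.h) (r := r) i
    have h2 := T.topParent_le (h := L.h) (r := r) (i - L.M)
    simp only [contents]
    split_ifs <;> omega

theorem contents_key_pos {h M : ℕ} {q : ℕ} (key : List ℕ → BitVec q) {u : List ℕ}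
    (hu : u ∈ T.nodes) :
    BitVec.ofNat q ((T.contents h r M key).key (T.pos h r u)) = key u := by
  simp [contents, nodeAt_pos hu]

theorem ident_lt {u : List ℕ} (hu : u ∈ T.nodes) (h : ℕ) :
    (T.ident h r u).1 < T.nodes.card + 2 ∧ (T.ident h r u).2 < T.nodes.card + 2 := by
  have h1 := T.length_lt_card hu
  have h2 := layerOfDepth_le (h := h) (r := r) u.length
  have h3 := Nat.div_le_self u.length h
  have h4 := pos_lt_card (h := h) (r := r) hu
  rw [(ident_eq hu).2]
  refine ⟨?_, ?_⟩
  · show layerOfDepth h r u.length < _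
    omega
  · show T.pos h r u - _ + 1 < _
    omega

open BlockReader

/-- One round of the query algorithm reports the path from `u` to its ancestor on the top level of
its layer, and ends in the state for the parent of this ancestor. -/
theorem eval_round {O : Type} {β : ℕ} (hβ : 0 < β) (out : ℕ × ℕ → BitVec L.q → O)
    (hL : L.Valid) (hh : 0 < L.h) (hr : 0 < r) (hrh : r ≤ L.h) (hN : T.nodes.card = L.N)
    (hMg : 2 * L.M ≤ L.g * L.s) (hM : L.N / L.h + 2 < L.M)
    (htop : T.topRank L.h r T.nodes.card ≤ L.M)
    (key : List ℕ → BitVec L.q) {u : List ℕ} (hu : u ∈ T.nodes) :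
    (L.round hβ out (L.toState (T.ident L.h r u))).eval
      (L.disk (T.contents L.h r L.M key)) =
    ((List.range (relDepth L.h r u.length + 1)).map fun t =>
        out (T.ident L.h r (u.take (u.length - t))) (key (u.take (u.length - t))),
      if layerOfDepth L.h r u.length ≤ 1 then none else
        some (L.toState (T.ident L.h r (u.take (u.length - relDepth L.h r u.length - 1))))) := by
  set c := T.contents L.h r L.M key with hc
  have hF : L.Fits c := fits_contents hh hrh hN key
  set D := L.disk c with hD
  obtain ⟨hst, hid⟩ := ident_eq (h := L.h) (r := r) hu
  set l := layerOfDepth L.h r u.length with hl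
  set st := T.layerStart L.h r l with hst'
  set i := T.pos L.h r u with hi
  have hiN : i < L.N := hN ▸ pos_lt_card hu
  have hlM : l < L.M := by
    have h1 := layerOfDepth_le (h := L.h) (r := r) u.length
    have h2 := Nat.div_le_div_right (c := L.h) (T.length_lt_card hu).le
    rw [hN] at h2
    omega
  have hmono : ∀ a, a < 2 * L.M → (readMono hβ L.s L.b L.g L.monoStart a).eval D = c.seq a :=
    fun a ha => eval_readMono hβ hF.seq_mono hF.seq_le hL.s_pos hL.far hL.ptr (by omega)
      (L.holds_disk c).2.2.2.2.2
  have hseq : ∀ a, a < L.M → c.seq a = T.layerStart L.h r a := fun a ha => if_pos ha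
  have hid1 : ((L.toState (T.ident L.h r u)).1 : ℕ) = l := by
    have := (T.ident_lt (r := r) hu L.h).1
    rw [hN] at this
    show (T.ident L.h r u).1 % _ = l
    rw [Nat.mod_eq_of_lt this, hid]
  have hid2 : ((L.toState (T.ident L.h r u)).2 : ℕ) = i - st + 1 := by
    have := (T.ident_lt (r := r) hu L.h).2
    rw [hN] at this
    show (T.ident L.h r u).2 % _ = i - st + 1
    rw [Nat.mod_eq_of_lt this, hid]
  unfold Layout.round
  simp only [eval_bind, hid1, hid2]
  rw [hmono l (by omega), hseq l hlM, ← hst', show st + (i - st + 1) - 1 = i by omega]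
  -- the first position of the block of `u`
  have hji : i / L.A * L.A ≤ i := Nat.div_mul_le_self i L.A
  have hij : i < i / L.A * L.A + L.A := Nat.lt_div_mul_add (a := i) hL.A_pos
  set j := i / L.A with hj
  have hhead := ((L.holds_disk c).2.2.1).flatMap_const (w := 2 * L.b) (t := j)
    (fun _ => by simp; ring) (Nat.lt_succ_of_le (Nat.div_le_div_right hiN.le))
  have hcle := hF.depth_le (j * L.A)
  have hrle : c.topRank (j * L.A) ≤ j * L.A := Nat.count_le _
  have hfar := hL.far
  have hvh1 : natAt ((readRange hβ (L.headStart + j * (2 * L.b)) (2 * L.b)).eval D)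
      (L.headStart + j * (2 * L.b)) L.b = c.depth (j * L.A) := by
    rw [← natAt_eq_of_holds hhead.left (by omega)]
    exact natAt_congr fun y h1 h2 => eval_readRange hβ D h1 (by omega)
  have hvh2 : natAt ((readRange hβ (L.headStart + j * (2 * L.b)) (2 * L.b)).eval D)
      (L.headStart + j * (2 * L.b) + L.b) L.b = c.topRank (j * L.A) := by
    have h1 := natAt_eq_of_holds hhead.right (show c.topRank (j * L.A) < 2 ^ L.b by omega)
    rw [length_bitsOf] at h1
    rw [← h1]
    exact natAt_congr fun y h1 h2 => eval_readRange hβ D (by omega) (by omega)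
  simp only [hvh1, hvh2]
  set x₀ := 2 * (j * L.A) - c.depth (j * L.A) with hx₀
  generalize hvt : (readRange hβ x₀ (2 * L.A + L.h)).eval D = vt
  generalize hvk : (readRange hβ (L.keyStart + j * L.A * L.q) (L.A * L.q)).eval D = vk
  generalize hvn : (readRange hβ (L.nearStart + (j - 1) * (L.h * (L.X + L.q)))
    (L.h * (L.X + L.q))).eval D = vn
  generalize hvf : (readRange hβ (L.farStart + (j / L.S - 1) * (L.h * L.b))
    (L.h * L.b)).eval D = vf
  have hvt' : ∀ y, x₀ ≤ y → y < x₀ + (2 * L.A + L.h) → vt y = D.getD y false :=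
    fun y h1 h2 => hvt ▸ eval_readRange hβ D h1 h2
  have hvt'' : ∀ y, x₀ ≤ y → y ≤ 2 * i - c.depth i → vt y = D.getD y false := by
    intro y h1 h2
    refine hvt' y h1 ?_
    have := hF.depth_lt (j * L.A)
    omega
  have hdec : Layout.decodeDepth vt (j * L.A) x₀ i = relDepth L.h r u.length := by
    rw [Layout.decodeDepth_eq hF hji hiN hvt'']
    exact relDepthAt_pos hu
  have hkl : relDepth L.h r u.length ≤ u.length := relDepth_le _
  -- the ancestors in the layer
  have hdepth : ∀ t ≤ relDepth L.h r u.length,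
      relDepth L.h r (u.length - t) = relDepth L.h r u.length - t := by
    intro t ht
    have := relDepth_add_of_layer_eq (Nat.sub_le u.length t)
      (layerOfDepth_sub_relDepth (r := r) hh ht)
    omega
  have hanc : ∀ t ≤ relDepth L.h r u.length,
      T.pos L.h r (u.take (u.length - t)) ≤ i ∧
      c.depth (T.pos L.h r (u.take (u.length - t))) = relDepth L.h r u.length - t ∧
      ∀ y, T.pos L.h r (u.take (u.length - t)) < y → y ≤ i →
        c.depth y ≠ relDepth L.h r u.length - t := by
    intro t ht
    have hlen : (u.take (u.length - t)).length = u.length - t := by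
      rw [List.length_take]; omega
    have hmem := T.take_mem hu (u.length - t)
    refine ⟨(pos_le_pos_iff hmem hu).2 (sortKey_mono_of_prefix (List.take_prefix _ _)), ?_, ?_⟩
    · show T.relDepthAt L.h r _ = _
      rw [relDepthAt_pos hmem, hlen, hdepth t ht]
    · intro y h1 h2
      have h3 := relDepth_lt_relDepthAt hu (List.take_prefix (u.length - t) u)
        (by rw [hlen]; exact layerOfDepth_sub_relDepth hh ht) h1 h2
      rw [hlen, hdepth t ht] at h3
      exact ne_of_gt h3
  have hout : ((List.range (Layout.decodeDepth vt (j * L.A) x₀ i + 1)).map fun t =>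
      out (l, (L.ancestor vt vk vn vf j x₀ i (Layout.decodeDepth vt (j * L.A) x₀ i - t)).1 - st + 1)
        (BitVec.ofNat L.q (L.ancestor vt vk vn vf j x₀ i
          (Layout.decodeDepth vt (j * L.A) x₀ i - t)).2)) =
      (List.range (relDepth L.h r u.length + 1)).map fun t =>
        out (T.ident L.h r (u.take (u.length - t))) (key (u.take (u.length - t))) := by
    rw [hdec]
    refine List.map_congr_left fun t ht => ?_
    have ht' : t ≤ relDepth L.h r u.length := by
      rw [List.mem_range] at ht
      omega
    obtain ⟨h1, h2, h3⟩ := hanc t ht'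
    have hmem := T.take_mem hu (u.length - t)
    have hlen : (u.take (u.length - t)).length = u.length - t := by
      rw [List.length_take]; omega
    rw [Layout.ancestor_eq hL hF hiN hj hvt'
      (fun y h1 h2 => hvk ▸ eval_readRange hβ D h1 h2)
      (fun y h1 h2 => hvn ▸ eval_readRange hβ D h1 h2)
      (fun y h1 h2 => hvf ▸ eval_readRange hβ D h1 h2) h1 h2 h3, contents_key_pos key hmem,
      (ident_eq hmem).2, hlen, layerOfDepth_sub_relDepth hh ht']
  by_cases hl1 : l ≤ 1
  · rw [if_pos hl1, if_pos hl1, eval, hout]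
  · rw [if_neg hl1, if_neg hl1]
    -- the ancestor on the top level of the layer, and its parent
    obtain ⟨h1, h2, h3⟩ := hanc _ le_rfl
    rw [Nat.sub_self] at h2 h3
    set k := relDepth L.h r u.length with hk
    have hkl' : k < u.length := by
      refine lt_of_le_of_ne hkl fun h4 => ?_
      have := (layerOfDepth_eq_one_iff (h := L.h) hr).2 h4
      omega
    have hmem := T.take_mem hu (u.length - k)
    have hlen : (u.take (u.length - k)).length = u.length - k := by
      rw [List.length_take]; omega
    have hdrop : (u.take (u.length - k)).dropLast = u.take (u.length - k - 1) := by
      rw [List.dropLast_eq_take, hlen, List.take_take]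
      congr 1
      omega
    have hmem' := T.take_mem hu (u.length - k - 1)
    have hlen' : (u.take (u.length - k - 1)).length = u.length - k - 1 := by
      rw [List.length_take]; omega
    have htop0 : relDepth L.h r (u.take (u.length - k)).length = 0 := by
      rw [hlen, hdepth k le_rfl, Nat.sub_self]
    have hrank := Layout.topRank_eq hF hiN hji hvt'' h1 h2 h3
    rw [← hx₀] at hrank
    have hpl : layerOfDepth L.h r (u.take (u.length - k - 1)).length = l - 1 := by
      have h4 := layerOfDepth_succ_of_eq_zero (h := L.h) (r := r) (d := u.length - k - 1)
        (by rw [Nat.sub_add_cancel (by omega), ← hlen]; exact htop0)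
      rw [Nat.sub_add_cancel (by omega), layerOfDepth_sub_relDepth hh le_rfl] at h4
      rw [hlen']
      omega
    have hrM : c.topRank (T.pos L.h r (u.take (u.length - k))) < L.M := by
      refine lt_of_lt_of_le ?_ htop
      exact Nat.count_strict_mono (p := fun i => T.relDepthAt L.h r i = 0)
        (by rw [relDepthAt_pos hmem, htop0]) (pos_lt_card hmem)
    have hpar : c.seq (L.M + c.topRank (T.pos L.h r (u.take (u.length - k)))) =
        L.N + T.pos L.h r (u.take (u.length - k - 1)) := by
      show (if _ then _ else _) = _
      rw [if_neg (by omega), Nat.add_sub_cancel_left, hN, ← hdrop]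
      congr 1
      exact topParent_topRank hmem htop0
    simp only [eval_bind, eval, hrank]
    rw [hmono _ (by omega), hpar, hmono _ (by omega), hseq _ (by omega), hout,
      Nat.add_sub_cancel_left, (ident_eq hmem').2, hpl]

/-- Iterating the rounds reports the path to the root, in one round for each layer. -/
theorem rounds_rootPath {O : Type} {β : ℕ} (hβ : 0 < β) (out : ℕ × ℕ → BitVec L.q → O)
    (hL : L.Valid) (hh : 0 < L.h) (hr : 0 < r) (hrh : r ≤ L.h) (hN : T.nodes.card = L.N)
    (hMg : 2 * L.M ≤ L.g * L.s) (hM : L.N / L.h + 2 < L.M)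
    (htop : T.topRank L.h r T.nodes.card ≤ L.M)
    (key : List ℕ → BitVec L.q) {u : List ℕ} (hu : u ∈ T.nodes) :
    Rounds (L.disk (T.contents L.h r L.M key)) (L.round hβ out) (L.toState (T.ident L.h r u))
      ((rootPath u).map fun v => out (T.ident L.h r v) (key v))
      (layerOfDepth L.h r u.length) := by
  induction hn : u.length using Nat.strong_induction_on generalizing u with
  | _ n ih =>
    subst hn
    have he := eval_round hβ out hL hh hr hrh hN hMg hM htop key hu
    have hp := layerOfDepth_pos (h := L.h) (r := r) u.length
    have hkl : relDepth L.h r u.length ≤ u.length := relDepth_le _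
    by_cases hl1 : layerOfDepth L.h r u.length ≤ 1
    · rw [if_pos hl1] at he
      have hl1' : layerOfDepth L.h r u.length = 1 := by omega
      rw [(layerOfDepth_eq_one_iff hr).1 hl1'] at he
      rw [hl1', rootPath_eq_map_take, List.map_map]
      exact Rounds.last _ _ he
    · rw [if_neg hl1] at he
      have hkl' : relDepth L.h r u.length < u.length := by
        refine lt_of_le_of_ne hkl fun h4 => ?_
        have := (layerOfDepth_eq_one_iff (h := L.h) hr).2 h4
        omega
      set k := relDepth L.h r u.length with hk
      have hlen' : (u.take (u.length - k - 1)).length = u.length - k - 1 := by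
        rw [List.length_take]; omega
      have h4 : layerOfDepth L.h r u.length = layerOfDepth L.h r (u.length - k - 1) + 1 := by
        rw [← layerOfDepth_sub_relDepth hh (i := k) (by omega)]
        have h5 : relDepth L.h r (u.length - k) = 0 := by
          have := relDepth_add_of_layer_eq (Nat.sub_le u.length k)
            (layerOfDepth_sub_relDepth (r := r) hh (i := k) (by omega))
          omega
        have := layerOfDepth_succ_of_eq_zero (h := L.h) (r := r) (d := u.length - k - 1)
          (by rwa [Nat.sub_add_cancel (by omega)])
        rwa [Nat.sub_add_cancel (by omega)] at this
      rw [rootPath_split u hkl', List.map_append, List.map_map, h4]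
      exact Rounds.step _ _ _ _ _ he
        (ih _ (by omega) (T.take_mem hu (u.length - k - 1)) hlen')

end OrdinalTree

open OrdinalTree in
/-- The query algorithm for a given layout. -/
theorem Layout.exists_reportsRootPaths {O : Type} {β m : ℕ} (L : Layout) (hL : L.Valid)
    (hβ : 0 < β) (hh : 0 < L.h) (hMg : 2 * L.M ≤ L.g * L.s) (hM : L.N / L.h + 2 < L.M)
    (hm : 1 + 2 * Nat.size (L.N + 1) + L.roundCost β + L.roundCost β * β ≤ m)
    (out : ℕ × ℕ → BitVec L.q → O) :
    ∃ P : DiskProgram (ℕ × ℕ) O β m, ∀ T : OrdinalTree, T.nodes.card = L.N →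
      ∀ key : List ℕ → BitVec L.q, ∃ r, 1 ≤ r ∧ r ≤ L.h ∧ ∃ D : List Bool,
        D.length ≤ L.monoStart +
          (L.g * (3 * L.b) + L.s * (L.g * (2 * Nat.size L.s) + 2 * L.N / L.s ^ 2)) ∧
        P.ReportsRootPaths D T L.h r (fun v => out (T.ident L.h r v) (key v))
          fun K => ((K / L.h + 2 : ℕ) : ℝ) * (L.roundCost β + 1 : ℕ) := by
  have hσ : Fintype.card L.State ≤ 2 ^ (2 * Nat.size (L.N + 1)) := by
    have h1 : L.N + 2 ≤ 2 ^ Nat.size (L.N + 1) := Nat.lt_size_self (L.N + 1)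
    rw [Fintype.card_prod, Fintype.card_fin, two_mul, pow_add]
    exact Nat.mul_le_mul h1 h1
  obtain ⟨P, hP⟩ := BlockReader.exists_diskProgram (L.round hβ out) (Layout.depthLE_round hβ out)
    L.toState hσ hm
  refine ⟨P, fun T hN key => ?_⟩
  obtain ⟨r, hr1, hrh, hrt⟩ := T.exists_few_layer_tops hh
  refine ⟨r, hr1, hrh, L.disk (T.contents L.h r L.M key), ?_, fun u hu => ?_⟩
  · have hF := fits_contents hh hrh hN key
    rw [L.length_disk]
    refine Nat.add_le_add_left ((length_monoBits_le hF.seq_mono hF.seq_le _ _ _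
      (2 * Nat.size L.s)).trans ?_) _
    refine Nat.add_le_add_left (Nat.mul_le_mul_left _ (Nat.add_le_add_left
      (Nat.div_le_div_left ?_ (pow_pos hL.s_pos 2)) _)) _
    rw [mul_comm, pow_mul]
    exact Nat.pow_le_pow_left (Nat.lt_size_self L.s).le 2
  · have htop : T.topRank L.h r T.nodes.card ≤ L.M := by
      rw [topRank_card]
      rw [hN] at hrt
      omega
    obtain ⟨n, hn, hrun⟩ := hP _ _ _ _
      (rounds_rootPath hβ out hL hh hr1 hrh hN hMg hM htop key hu)
    refine ⟨n, ?_, hrun⟩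
    show (n : ℝ) ≤ _ * _
    rw [← Nat.cast_mul, Nat.cast_le]
    exact hn.trans (Nat.mul_le_mul_right _ (layerOfDepth_le _))

/-! ### Choice of the parameters -/

/-- The layout used for a tree with `N` nodes and `q`-bit keys in layers of height `h`, on disk
blocks of `B` words of `w` bits: a block represents about `4 * B * w / (q + 2)` nodes, and a
superblock consists of about `log log N` blocks. Fields of `2 * Nat.size N + 4` bits hold not only
positions but also the pointers into the stored monotone sequence. As at most `N / h + 1` nodes are
on top levels of layers, `N / h + 3` bounds their number and the number of layers. -/
def stdLayout (N B w q h : ℕ) : Layout where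
  N := N
  h := h
  q := q
  A := 4 * (B * w) / (q + 2) + 1
  S := Nat.size (Nat.size N)
  X := Nat.size ((4 * (B * w) / (q + 2) + 1) * Nat.size (Nat.size N))
  b := 2 * Nat.size N + 4
  s := Nat.size N
  g := 2 * (N / h + 3) / Nat.size N + 1
  M := N / h + 3

theorem two_le_size {N : ℕ} (hN : 2 ≤ N) : 2 ≤ Nat.size N := Nat.lt_size.2 hN

theorem Nat.size_le_self (n : ℕ) : Nat.size n ≤ n := Nat.size_le.2 Nat.lt_two_pow_self

theorem Nat.size_mul_le (m n : ℕ) : Nat.size (m * n) ≤ Nat.size m + Nat.size n := by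
  rw [Nat.size_le, pow_add]
  exact Nat.mul_lt_mul'' (Nat.lt_size_self m) (Nat.lt_size_self n)

/-- Two applications of this bound show that `log log N` times a quantity of order `N / log N`, or of
order `log N`, is still `O(N / log log N)`. -/
theorem sq_size_le (n : ℕ) : Nat.size n ^ 2 ≤ 8 * n := by
  rcases Nat.eq_zero_or_pos n with rfl | hn
  · simp
  have h1 : 0 < Nat.size n := Nat.size_pos.2 hn
  have h2 : 2 ^ (Nat.size n - 1) ≤ n := Nat.lt_size.1 (by omega)
  obtain ⟨k, hk⟩ : ∃ k, Nat.size n = k + 1 := ⟨Nat.size n - 1, by omega⟩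
  rw [hk] at h2 ⊢
  rw [Nat.add_sub_cancel] at h2
  have h3 : ∀ k, (k + 1) ^ 2 ≤ 8 * 2 ^ k := by
    intro k
    induction k with
    | zero => norm_num
    | succ k ih =>
      rcases Nat.lt_or_ge k 2 with h | h
      · interval_cases k <;> norm_num
      · rw [pow_succ 2 k]
        nlinarith
  exact (h3 k).trans (Nat.mul_le_mul_left 8 h2)

theorem stdLayout_valid {N : ℕ} (hN : 2 ≤ N) (B w q h : ℕ) : (stdLayout N B w q h).Valid where
  A_pos := Nat.succ_pos _
  S_pos := Nat.size_pos.2 (by have := two_le_size hN; omega)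
  s_pos := by have := two_le_size hN; show 0 < Nat.size N; omega
  near := Nat.lt_size_self _
  far := by
    show 2 * N < 2 ^ (2 * Nat.size N + 4)
    have h1 := Nat.lt_size_self N
    have h2 : 2 ^ (Nat.size N + 1) ≤ 2 ^ (2 * Nat.size N + 4) :=
      Nat.pow_le_pow_right (by norm_num) (by omega)
    rw [pow_succ] at h2
    omega
  ptr := by
    show Nat.size N * ((2 * (N / h + 3) / Nat.size N + 1) * (2 * Nat.size N + 4)) <
      2 ^ (2 * Nat.size N + 4)
    set n := Nat.size N with hn
    have h2 : 2 ≤ n := two_le_size hN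
    have h1 : N < 2 ^ n := Nat.lt_size_self N
    have h3 : n < 2 ^ n := Nat.lt_two_pow_self
    have h4 : 2 ^ 2 ≤ 2 ^ n := Nat.pow_le_pow_right (by norm_num) h2
    -- the number of stored terms, including those that fill up the last group
    have h5 : n * (2 * (N / h + 3) / n + 1) ≤ 4 * 2 ^ n := by
      have h6 := Nat.mul_div_le (2 * (N / h + 3)) n
      have h7 := Nat.div_le_self N h
      rw [Nat.mul_add, Nat.mul_one]
      have h8 : n + 4 ≤ 2 * 2 ^ n := by omega
      omega
    have h6 : 2 * n + 4 < 4 * 2 ^ n := by omega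
    calc n * ((2 * (N / h + 3) / n + 1) * (2 * n + 4))
        = n * (2 * (N / h + 3) / n + 1) * (2 * n + 4) := by ring
      _ ≤ 4 * 2 ^ n * (2 * n + 4) := Nat.mul_le_mul_right _ h5
      _ < 4 * 2 ^ n * (4 * 2 ^ n) := Nat.mul_lt_mul_of_pos_left h6 (by positivity)
      _ = 2 ^ (2 * n + 4) := by ring

/-- The standing assumptions with integral constants and `Nat.size N` for `lg N`. -/
structure SizeAssumptions (a d a' e N B w q : ℕ) : Prop where
  two_le : 2 ≤ N
  block_pos : 0 < B
  block_le : B ≤ N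
  size_le_word : Nat.size N ≤ a * w
  word_le : w ≤ d * Nat.size N
  size_le_block : Nat.size N ≤ a' * B
  key_le : q ≤ e * w

namespace SizeAssumptions

variable {a d a' e N B w q : ℕ}

theorem word_pos (H : SizeAssumptions a d a' e N B w q) : 0 < w := by
  rcases Nat.eq_zero_or_pos w with rfl | h
  · have := H.size_le_word
    have := two_le_size H.two_le
    omega
  · exact h

theorem blockNodes_le (H : SizeAssumptions a d a' e N B w q) :
    4 * (B * w) / (q + 2) + 1 ≤ 3 * (B * w) := by
  have h1 : 0 < B * w := Nat.mul_pos H.block_pos H.word_pos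
  have h2 : 4 * (B * w) / (q + 2) ≤ 4 * (B * w) / 2 :=
    Nat.div_le_div_left (by omega) (by norm_num)
  omega

theorem nearWidth_le (H : SizeAssumptions a d a' e N B w q) (h : ℕ) :
    (stdLayout N B w q h).X ≤ (4 + d) * a * w := by
  show Nat.size ((4 * (B * w) / (q + 2) + 1) * Nat.size (Nat.size N)) ≤ _
  set n := Nat.size N with hn
  have h2 : 2 ≤ n := two_le_size H.two_le
  have hd : 1 ≤ d := by
    have h3 := H.word_pos
    have h4 := H.word_le
    rcases Nat.eq_zero_or_pos d with rfl | h5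
    · omega
    · exact h5
  have h3 : (4 * (B * w) / (q + 2) + 1) * Nat.size n ≤ 3 * (N * (d * n)) * n :=
    Nat.mul_le_mul (H.blockNodes_le.trans (Nat.mul_le_mul_left _
      (Nat.mul_le_mul H.block_le H.word_le))) (Nat.size_le_self n)
  have h4 : Nat.size (3 * (N * (d * n)) * n) ≤ 2 + (n + (d + n)) + n := by
    refine (Nat.size_mul_le _ _).trans (Nat.add_le_add ((Nat.size_mul_le _ _).trans
      (Nat.add_le_add (Nat.size_le.2 (by norm_num)) ((Nat.size_mul_le _ _).trans
      (Nat.add_le_add le_rfl ((Nat.size_mul_le _ _).trans (Nat.add_le_add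
      (Nat.size_le_self d) (Nat.size_le_self n))))))) (Nat.size_le_self n))
  calc _ ≤ 2 + (n + (d + n)) + n := (Nat.size_le_size h3).trans h4
    _ ≤ (4 + d) * n := by nlinarith
    _ ≤ (4 + d) * (a * w) := Nat.mul_le_mul_left _ H.size_le_word
    _ = _ := by ring

/-- The number of I/Os for one layer of a path is bounded by a constant. -/
theorem roundCost_le (H : SizeAssumptions a d a' e N B w q) {h : ℕ} (hB : h ≤ B) :
    (stdLayout N B w q h).roundCost (B * w) ≤
      3 * (12 * a + 4 * a) + 8 * a + 7 + (4 + e) + ((4 + d) * a + e) + 4 * a + 22 := by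
  have hβ : 0 < B * w := Nat.mul_pos H.block_pos H.word_pos
  have hw : w ≤ B * w := Nat.le_mul_of_pos_left _ H.block_pos
  have hBβ : B ≤ B * w := Nat.le_mul_of_pos_right _ H.word_pos
  have h2 := two_le_size H.two_le
  have hb : 2 * Nat.size N + 4 ≤ 4 * a * w := by
    have h1 := H.size_le_word
    have h3 : 4 * a * w = 4 * (a * w) := by ring
    omega
  have haw : 4 * a * w ≤ 4 * a * (B * w) := Nat.mul_le_mul_left _ hw
  have hA := H.blockNodes_le
  have hX := H.nearWidth_le h
  have hq := H.key_le
  have hew : e * w ≤ e * (B * w) := Nat.mul_le_mul_left _ hw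
  unfold Layout.roundCost
  show 3 * (3 * (2 * Nat.size N + 4) / (B * w) + (2 * Nat.size N + 4) / (B * w)) +
    2 * (2 * Nat.size N + 4) / (B * w) + (2 * (4 * (B * w) / (q + 2) + 1) + h) / (B * w) +
    (4 * (B * w) / (q + 2) + 1) * q / (B * w) +
    h * ((stdLayout N B w q h).X + q) / (B * w) + h * (2 * Nat.size N + 4) / (B * w) + 22 ≤ _
  have e1 : 3 * (2 * Nat.size N + 4) / (B * w) ≤ 12 * a :=
    Nat.div_le_of_le_mul (by rw [mul_comm]; nlinarith)
  have e2 : (2 * Nat.size N + 4) / (B * w) ≤ 4 * a :=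
    Nat.div_le_of_le_mul (by rw [mul_comm]; nlinarith)
  have e3 : 2 * (2 * Nat.size N + 4) / (B * w) ≤ 8 * a :=
    Nat.div_le_of_le_mul (by rw [mul_comm]; nlinarith)
  have e4 : (2 * (4 * (B * w) / (q + 2) + 1) + h) / (B * w) ≤ 7 :=
    Nat.div_le_of_le_mul (by omega)
  have e5 : (4 * (B * w) / (q + 2) + 1) * q / (B * w) ≤ 4 + e := by
    refine Nat.div_le_of_le_mul ?_
    have h3 : 4 * (B * w) / (q + 2) * q ≤ 4 * (B * w) :=
      (Nat.mul_le_mul_left _ (by omega)).trans (Nat.div_mul_le_self _ (q + 2))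
    have h4 : B * w * (4 + e) = 4 * (B * w) + e * (B * w) := by ring
    rw [Nat.add_mul, Nat.one_mul, h4]
    omega
  have e6 : h * ((stdLayout N B w q h).X + q) / (B * w) ≤ (4 + d) * a + e := by
    refine Nat.div_le_of_le_mul ?_
    calc _ ≤ B * ((4 + d) * a * w + e * w) := Nat.mul_le_mul hB (Nat.add_le_add hX hq)
      _ = _ := by ring
  have e7 : h * (2 * Nat.size N + 4) / (B * w) ≤ 4 * a := by
    refine Nat.div_le_of_le_mul ?_
    calc _ ≤ B * (4 * a * w) := Nat.mul_le_mul hB hb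
      _ = _ := by ring
  omega

end SizeAssumptions

/-! ### The length of the representation -/

theorem lg_le_size (N : ℕ) (hN : 1 ≤ N) : lg N ≤ Nat.size N := by
  have h1 : (N : ℝ) ≤ 2 ^ (Nat.size N) := by exact_mod_cast (Nat.lt_size_self N).le
  have h2 : (0 : ℝ) < N := by exact_mod_cast hN
  rw [lg, Real.logb_le_iff_le_rpow (by norm_num) h2, Real.rpow_natCast]
  exact h1

theorem size_le_lg_add_one (N : ℕ) (hN : 1 ≤ N) : (Nat.size N : ℝ) ≤ lg N + 1 := by
  have h0 : 0 < Nat.size N := Nat.size_pos.2 hN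
  have h1 : ((2 : ℝ) ^ (Nat.size N - 1)) ≤ N := by
    exact_mod_cast Nat.lt_size.1 (show Nat.size N - 1 < Nat.size N by omega)
  have h2 : (0 : ℝ) < N := by exact_mod_cast hN
  have h3 : ((Nat.size N - 1 : ℕ) : ℝ) ≤ lg N := by
    rw [lg, Real.le_logb_iff_rpow_le (by norm_num) h2, Real.rpow_natCast]
    exact h1
  rw [Nat.cast_sub h0] at h3
  push_cast at h3
  linarith

theorem one_le_lg {N : ℕ} (hN : 2 ≤ N) : 1 ≤ lg N := by
  have h2 : (0 : ℝ) < N := by positivity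
  rw [lg, Real.le_logb_iff_rpow_le (by norm_num) h2, Real.rpow_one]
  exact_mod_cast hN

theorem sizeAssumptions_of_model {cB cw Cw Cq : ℝ} (hcB : 0 < cB) (hcw : 0 < cw) {N B w q : ℕ}
    (H : ModelAssumptions cB cw Cw N B w) (hq : (q : ℝ) ≤ Cq * lg N) :
    SizeAssumptions ⌈2 / cw⌉₊ ⌈Cw⌉₊ ⌈2 / cB⌉₊ (⌈Cq⌉₊ * ⌈2 / cw⌉₊) N B w q := by
  have hN := H.two_le
  have h1 := one_le_lg hN
  have h2 := lg_le_size N (by omega)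
  have h3 : (Nat.size N : ℝ) ≤ 2 * lg N := by
    have := size_le_lg_add_one N (by omega)
    linarith
  have hsize : ∀ {c : ℝ} {x : ℕ}, 0 < c → c * lg N ≤ x → Nat.size N ≤ ⌈2 / c⌉₊ * x := by
    intro c x hc hx
    have h4 : (Nat.size N : ℝ) ≤ ⌈2 / c⌉₊ * x := by
      calc (Nat.size N : ℝ) ≤ 2 * lg N := h3
        _ = 2 / c * (c * lg N) := by field_simp
        _ ≤ ⌈2 / c⌉₊ * x := by
          gcongr
          exact Nat.le_ceil _
    exact_mod_cast h4
  have hw := hsize hcw H.word_lower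
  refine ⟨hN, ?_, H.block_upper, hw, ?_, hsize hcB H.block_lower, ?_⟩
  · have : (0 : ℝ) < B := lt_of_lt_of_le (by positivity) H.block_lower
    exact_mod_cast this
  · have h4 : (w : ℝ) ≤ ⌈Cw⌉₊ * Nat.size N :=
      H.word_upper.trans (mul_le_mul (Nat.le_ceil _) h2 (by linarith) (by positivity))
    exact_mod_cast h4
  · have h4 : (q : ℝ) ≤ ⌈Cq⌉₊ * Nat.size N :=
      hq.trans (mul_le_mul (Nat.le_ceil _) h2 (by linarith) (by positivity))
    have h5 : q ≤ ⌈Cq⌉₊ * Nat.size N := by exact_mod_cast h4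
    rw [mul_assoc]
    exact h5.trans (Nat.mul_le_mul_left _ hw)

/-- The gauge for the lower order terms: `N` divided by (roughly) `log log N`. -/
noncomputable def lowOrder (N : ℕ) : ℝ := N / Nat.size (Nat.size N)

theorem lowOrder_isLittleO (K : ℝ) :
    (fun N => K * lowOrder N) =o[Filter.atTop] fun N : ℕ => (N : ℝ) := by
  have hsize : Filter.Tendsto Nat.size Filter.atTop Filter.atTop := by
    refine Filter.tendsto_atTop.2 fun b => ?_
    filter_upwards [Filter.eventually_ge_atTop (2 ^ b)] with N hN
    exact (Nat.lt_size.2 hN).le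
  have h1 : Filter.Tendsto (fun N : ℕ => ((Nat.size (Nat.size N) : ℕ) : ℝ)⁻¹) Filter.atTop
      (nhds 0) :=
    tendsto_inv_atTop_zero.comp (tendsto_natCast_atTop_atTop.comp (hsize.comp hsize))
  have h2 := ((Asymptotics.isLittleO_one_iff ℝ).2 h1).mul_isBigO
    (Asymptotics.isBigO_refl (fun N : ℕ => (N : ℝ)) Filter.atTop)
  refine Asymptotics.IsLittleO.const_mul_left ?_ K
  refine h2.congr (fun N => ?_) fun N => ?_
  · rw [lowOrder]; ring
  · ring

namespace SizeAssumptions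

variable {a d a' e N B w q : ℕ}

/-- The lower order terms that occur in the length of the representation are bounded by the gauge. -/
theorem lowOrder_bounds (hN : 2 ≤ N) : 0 ≤ lowOrder N ∧
    (N : ℝ) * Nat.size (Nat.size N) / Nat.size N ≤ 8 * lowOrder N ∧
    (Nat.size N : ℝ) * Nat.size (Nat.size N) ≤ 64 * lowOrder N := by
  have h2 := two_le_size hN
  have h3 : 0 < Nat.size (Nat.size N) := Nat.size_pos.2 (by omega)
  have h4 := sq_size_le N
  have h5 := sq_size_le (Nat.size N)
  set n := Nat.size N
  set S := Nat.size n
  have h2' : (0 : ℝ) < n := by exact_mod_cast (by omega : 0 < n)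
  have h3' : (0 : ℝ) < S := by exact_mod_cast h3
  have h4' : (n : ℝ) ^ 2 ≤ 8 * N := by exact_mod_cast h4
  have h5' : (S : ℝ) ^ 2 ≤ 8 * n := by exact_mod_cast h5
  refine ⟨by unfold lowOrder; positivity, ?_, ?_⟩
  · have : 8 * lowOrder N = 8 * N / S := by rw [lowOrder]; ring
    rw [this, div_le_div_iff₀ h2' h3']
    calc (N : ℝ) * S * S = N * S ^ 2 := by ring
      _ ≤ N * (8 * n) := by gcongr
      _ = _ := by ring
  · have : 64 * lowOrder N = 64 * N / S := by rw [lowOrder]; ring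
    rw [this, le_div_iff₀ h3']
    calc (n : ℝ) * S * S = n * S ^ 2 := by ring
      _ ≤ n * (8 * n) := by gcongr
      _ = 8 * n ^ 2 := by ring
      _ ≤ 8 * (8 * N) := by gcongr
      _ = _ := by ring

/-- The entry width of block records is about `2 * lg B`, because a superblock represents
`O(B * w * log log N)` nodes and `w = O(B)`. -/
theorem nearWidth_le_lg (H : SizeAssumptions a d a' e N B w q) (h : ℕ) :
    ((stdLayout N B w q h).X : ℝ) ≤
      2 * lg B + (2 + Nat.size (3 * (d * a'))) + Nat.size (Nat.size N) := by
  show ((Nat.size ((4 * (B * w) / (q + 2) + 1) * Nat.size (Nat.size N)) : ℕ) : ℝ) ≤ _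
  have h1 : (4 * (B * w) / (q + 2) + 1) * Nat.size (Nat.size N) ≤
      3 * (d * a') * (B * B) * Nat.size (Nat.size N) := by
    refine Nat.mul_le_mul_right _ (H.blockNodes_le.trans ?_)
    have h2 : w ≤ d * (a' * B) := H.word_le.trans (Nat.mul_le_mul_left _ H.size_le_block)
    calc 3 * (B * w) ≤ 3 * (B * (d * (a' * B))) := by gcongr
      _ = _ := by ring
  have h2 : Nat.size (3 * (d * a') * (B * B) * Nat.size (Nat.size N)) ≤
      Nat.size (3 * (d * a')) + (Nat.size B + Nat.size B) + Nat.size (Nat.size N) :=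
    (Nat.size_mul_le _ _).trans (Nat.add_le_add ((Nat.size_mul_le _ _).trans
      (Nat.add_le_add le_rfl (Nat.size_mul_le _ _))) (Nat.size_le_self _))
  have h3 := size_le_lg_add_one B H.block_pos
  have h4 : ((Nat.size ((4 * (B * w) / (q + 2) + 1) * Nat.size (Nat.size N)) : ℕ) : ℝ) ≤
      Nat.size (3 * (d * a')) + (Nat.size B + Nat.size B) + Nat.size (Nat.size N) := by
    exact_mod_cast (Nat.size_le_size h1).trans h2
  linarith

section RealBounds

/- In the following bounds, `m` is the number of blocks, `u` stands for `(q + 2) * N`, `n` for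
`Nat.size N` and `S` for `Nat.size n`. -/

variable {a a' u m n S B w x q lgB τ h X N z : ℝ}

theorem headBits_bound (ha : 0 ≤ a) (hu : 0 ≤ u) (hn : 2 ≤ n) (hS : 1 ≤ S)
    (hB : 0 < B) (hw : 0 < w) (hm : m ≤ u / (4 * (B * w))) (hnw : n ≤ a * w)
    (hnB : n ≤ a' * B) :
    (m + 1) * (2 * (2 * n + 4)) ≤ 2 * (a * a') * (u * S / n) + 8 * (n * S) := by
  have hn0 : 0 < n := by linarith
  have hB1 : 1 / B ≤ a' / n := by
    rw [div_le_div_iff₀ hB hn0]; linarith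
  have hw1 : n / w ≤ a := by
    rw [div_le_iff₀ hw]; linarith
  have ha' : 0 ≤ a' := by
    by_contra! h
    nlinarith
  have h1 : n ≤ n * S := le_mul_of_one_le_right hn0.le hS
  have h2 : u ≤ u * S := le_mul_of_one_le_right hu hS
  calc (m + 1) * (2 * (2 * n + 4)) ≤ (u / (4 * (B * w)) + 1) * (8 * n) :=
        mul_le_mul (by linarith) (by linarith) (by linarith) (by positivity)
    _ = 2 * u * (n / w * (1 / B)) + 8 * n := by field_simp; ring
    _ ≤ 2 * u * (a * (a' / n)) + 8 * n := by
        have := mul_le_mul hw1 hB1 (by positivity) ha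
        have := mul_le_mul_of_nonneg_left this (show 0 ≤ 2 * u by linarith)
        linarith
    _ = 2 * (a * a') * (u / n) + 8 * n := by ring
    _ ≤ 2 * (a * a') * (u * S / n) + 8 * (n * S) := by
        have := mul_le_mul_of_nonneg_left (div_le_div_of_nonneg_right h2 hn0.le)
          (show 0 ≤ 2 * (a * a') by positivity)
        linarith

theorem nearBits_bound (hu : 0 ≤ u) (hn : 2 ≤ n) (hS : 1 ≤ S)
    (hB : 0 < B) (hw : 0 < w) (hm : m ≤ u / (4 * (B * w))) (hnw : n ≤ a * w)
    (hnB : n ≤ a' * B) (hτ : 0 < τ) (hτ1 : τ < 1) (hh0 : 0 ≤ h) (hh : h ≤ τ * B + 1)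
    (hX0 : 0 ≤ X + q) (hx : 0 ≤ x) (hX : X ≤ 2 * lgB + (2 + x) + S) (hXw : X + q ≤ z * w) :
    m * (h * (X + q)) ≤ τ * u * (q + 2 * lgB) / (4 * w) +
      (3 + x) * a * (u * S / n) + z * a' * (u * S / n) := by
  have hn0 : 0 < n := by linarith
  have hB1 : 1 / B ≤ a' / n := by
    rw [div_le_div_iff₀ hB hn0]; linarith
  have hw1 : 1 / w ≤ a / n := by
    rw [div_le_div_iff₀ hw hn0]; linarith
  have hz : 0 ≤ z := by
    by_contra! h
    nlinarith
  have h1 : X + q ≤ (q + 2 * lgB) + (3 + x) * S := by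
    have : (2 + x) ≤ (2 + x) * S := le_mul_of_one_le_right (by positivity) hS
    linarith
  have h2 : u ≤ u * S := le_mul_of_one_le_right hu hS
  have e1 : τ * u * ((3 + x) * S) * (1 / w) / 4 ≤ (3 + x) * a * (u * S / n) := by
    have h3 : 0 ≤ u * ((3 + x) * S) := by positivity
    have h4 := mul_le_mul_of_nonneg_left hw1 h3
    have h5 : 0 ≤ u * ((3 + x) * S) * (1 / w) := by positivity
    have h6 : u * ((3 + x) * S) * (a / n) = (3 + x) * a * (u * S / n) := by ring
    have h7 : τ * u * ((3 + x) * S) * (1 / w) = τ * (u * ((3 + x) * S) * (1 / w)) := by ring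
    have h8 := mul_le_of_le_one_left h5 hτ1.le
    rw [h7]
    linarith
  have e2 : u / (4 * (B * w)) * (z * w) ≤ z * a' * (u * S / n) := by
    have h3 : u / (4 * (B * w)) * (z * w) = u * z * (1 / B) / 4 := by field_simp
    have h4 : 0 ≤ u * z := by positivity
    have h5 := mul_le_mul_of_nonneg_left hB1 h4
    have h6 : 0 ≤ u * z * (1 / B) := by positivity
    have h7 : u * z * (a' / n) = z * (u / n * a') := by ring
    have h8 : z * (u / n * a') ≤ z * (u * S / n * a') := by
      have ha' : 0 ≤ a' := by
        by_contra! h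
        nlinarith
      exact mul_le_mul_of_nonneg_left (mul_le_mul_of_nonneg_right
        (div_le_div_of_nonneg_right h2 hn0.le) ha') hz
    rw [h3]
    linarith
  calc m * (h * (X + q)) ≤ u / (4 * (B * w)) * ((τ * B + 1) * (X + q)) :=
        mul_le_mul hm (mul_le_mul_of_nonneg_right hh hX0) (by positivity) (by positivity)
    _ = τ * u * (X + q) * (1 / w) / 4 + u / (4 * (B * w)) * (X + q) := by field_simp
    _ ≤ τ * u * ((q + 2 * lgB) + (3 + x) * S) * (1 / w) / 4 +
        u / (4 * (B * w)) * (z * w) := by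
        have h3 := mul_le_mul_of_nonneg_right (mul_le_mul_of_nonneg_left h1
          (show 0 ≤ τ * u by positivity)) (show 0 ≤ 1 / w by positivity)
        have h4 := mul_le_mul_of_nonneg_left hXw (show 0 ≤ u / (4 * (B * w)) by positivity)
        linarith
    _ = τ * u * (q + 2 * lgB) / (4 * w) + τ * u * ((3 + x) * S) * (1 / w) / 4 +
        u / (4 * (B * w)) * (z * w) := by field_simp
    _ ≤ _ := by linarith

theorem farBits_bound (hu : 0 ≤ u) (hn : 2 ≤ n) (hS : 1 ≤ S) (hB : 0 < B) (hw : 0 < w)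
    (hm : m ≤ u / (4 * (B * w)) / S) (hnw : n ≤ a * w) (hh0 : 0 ≤ h) (hh : h ≤ B) :
    m * (h * (2 * n + 4)) ≤ a * (u / S) := by
  have hw1 : n / w ≤ a := by
    rw [div_le_iff₀ hw]; linarith
  calc m * (h * (2 * n + 4)) ≤ u / (4 * (B * w)) / S * (B * (4 * n)) :=
        mul_le_mul hm (mul_le_mul hh (by linarith) (by linarith) hB.le) (by positivity)
          (by positivity)
    _ = n / w * (u / S) := by field_simp
    _ ≤ a * (u / S) := mul_le_mul_of_nonneg_right hw1 (by positivity)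

theorem monoBits_bound {g t : ℝ} (hN : 0 ≤ N) (hn : 2 ≤ n) (hS : 1 ≤ S) (hB : 0 < B) (hτ : 0 < τ)
    (hh0 : 0 < h) (hh : τ * B ≤ 2 * h) (hnB : n ≤ a' * B) (hg0 : 0 ≤ g)
    (hg : g * n ≤ 2 * (N / h + 3) + n) (ht : t ≤ 2 * N / n ^ 2) :
    g * (3 * (2 * n + 4)) + n * (g * (2 * S) + t) ≤
      56 * a' / τ * (N * S / n) + 56 * (n * S) + 2 * (N * S / n) := by
  have hn0 : 0 < n := by linarith
  have ha' : 0 ≤ a' := by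
    by_contra! h
    nlinarith
  have h1 : N / h ≤ 2 * a' / τ * (N / n) := by
    have h2 : 1 / h ≤ 2 * a' / (τ * n) := by
      rw [div_le_div_iff₀ hh0 (by positivity)]
      have h3 := mul_le_mul_of_nonneg_left hnB hτ.le
      have h4 := mul_le_mul_of_nonneg_left hh ha'
      linarith
    calc N / h = N * (1 / h) := by ring
      _ ≤ N * (2 * a' / (τ * n)) := mul_le_mul_of_nonneg_left h2 hN
      _ = _ := by field_simp
  have h3 : g * n ≤ 4 * a' / τ * (N / n) + 4 * n := by
    have : 2 * (2 * a' / τ * (N / n)) = 4 * a' / τ * (N / n) := by ring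
    linarith
  have h4 : n * t ≤ 2 * (N * S / n) := by
    calc n * t ≤ n * (2 * N / n ^ 2) := mul_le_mul_of_nonneg_left ht hn0.le
      _ = 2 * (N * 1 / n) := by field_simp
      _ ≤ 2 * (N * S / n) := by gcongr
  have h5 : 3 * (2 * n + 4) ≤ 12 * (n * S) := by
    have : n ≤ n * S := le_mul_of_one_le_right hn0.le hS
    linarith
  calc g * (3 * (2 * n + 4)) + n * (g * (2 * S) + t) ≤
        g * (12 * (n * S)) + n * (g * (2 * S)) + 2 * (N * S / n) := by
        have := mul_le_mul_of_nonneg_left h5 hg0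
        linarith
    _ = 14 * S * (g * n) + 2 * (N * S / n) := by ring
    _ ≤ 14 * S * (4 * a' / τ * (N / n) + 4 * n) + 2 * (N * S / n) := by
        have := mul_le_mul_of_nonneg_left h3 (show 0 ≤ 14 * S by linarith)
        linarith
    _ = _ := by ring

end RealBounds

/-- The length of the representation: besides the tree and the keys, only the block records
contribute a term that is not of lower order. -/
theorem length_le (H : SizeAssumptions a d a' e N B w q) {τ : ℝ} (hτ : 0 < τ) (hτ1 : τ < 1)
    {h : ℕ} (hhB : h ≤ B) (hh1 : (h : ℝ) ≤ τ * B + 1) (hh2 : τ * B ≤ 2 * h) (hh : 0 < h)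
    {L : Layout} (hL : L = stdLayout N B w q h) :
    ((L.monoStart + (L.g * (3 * L.b) + L.s * (L.g * (2 * Nat.size L.s) + 2 * L.N / L.s ^ 2)) : ℕ)
      : ℝ) ≤ (2 + q) * N + τ * N * (q + 2) * (q + 2 * lg B) / (4 * w) +
      (q + 2) * ((16 * a * a' + 8 * ((4 + d) * a + e) * a' + 8 * (3 + Nat.size (3 * (d * a'))) * a
        + a + 448 * a' / τ + 10000) * lowOrder N) := by
  obtain ⟨hZ0, hZ1, hZ2⟩ := lowOrder_bounds H.two_le
  have hX := H.nearWidth_le_lg h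
  have hXw : ((stdLayout N B w q h).X : ℝ) + q ≤ ((4 + d) * a + e) * w := by
    have h1 := H.nearWidth_le h
    have h2 := H.key_le
    have h3 : (stdLayout N B w q h).X + q ≤ ((4 + d) * a + e) * w := by
      rw [Nat.add_mul]; omega
    exact_mod_cast h3
  have hn2 := two_le_size H.two_le
  have hS1 : 1 ≤ Nat.size (Nat.size N) := Nat.size_pos.2 (by omega)
  have hSr : (1 : ℝ) ≤ Nat.size (Nat.size N) := by exact_mod_cast hS1
  have hnr : (2 : ℝ) ≤ Nat.size N := by exact_mod_cast hn2
  have hBr : (0 : ℝ) < B := by exact_mod_cast H.block_pos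
  have hwr : (0 : ℝ) < w := by exact_mod_cast H.word_pos
  have hhr : (0 : ℝ) < h := by exact_mod_cast hh
  have hnw : (Nat.size N : ℝ) ≤ a * w := by exact_mod_cast H.size_le_word
  have hnB : (Nat.size N : ℝ) ≤ a' * B := by exact_mod_cast H.size_le_block
  have hhBr : (h : ℝ) ≤ B := by exact_mod_cast hhB
  have hq0 : (0 : ℝ) ≤ q := Nat.cast_nonneg q
  have hu0 : (0 : ℝ) ≤ (q + 2) * N := by positivity
  have hsum : ((L.monoStart + (L.g * (3 * L.b) + L.s * (L.g * (2 * Nat.size L.s) +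
      2 * L.N / L.s ^ 2)) : ℕ) : ℝ) = 2 * N + N * q +
      (((N / L.A : ℕ) : ℝ) + 1) * (2 * (2 * Nat.size N + 4)) +
      ((N / L.A : ℕ) : ℝ) * (h * (L.X + q)) +
      ((N / (L.A * Nat.size (Nat.size N)) : ℕ) : ℝ) * (h * (2 * Nat.size N + 4)) +
      ((L.g : ℝ) * (3 * (2 * Nat.size N + 4)) +
      Nat.size N * (L.g * (2 * Nat.size (Nat.size N)) + ((2 * N / Nat.size N ^ 2 : ℕ) : ℝ))) := by
    subst hL
    simp only [Layout.monoStart, Layout.farStart, Layout.nearStart, Layout.headStart,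
      Layout.keyStart, stdLayout, Nat.cast_add, Nat.cast_mul, Nat.cast_ofNat, Nat.cast_one]
  have hA1 : (4 * (B * w) : ℝ) ≤ L.A * (q + 2) := by
    have h2 : 4 * (B * w) ≤ L.A * (q + 2) := by
      have := Nat.lt_div_mul_add (a := 4 * (B * w)) (b := q + 2) (by omega)
      rw [hL]
      show _ ≤ (4 * (B * w) / (q + 2) + 1) * (q + 2)
      rw [Nat.add_mul, Nat.one_mul]
      omega
    exact_mod_cast h2
  have hA0 : (0 : ℝ) < L.A := by
    rw [hL]
    exact_mod_cast Nat.succ_pos _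
  have hnA : ((N / L.A : ℕ) : ℝ) ≤ (q + 2) * N / (4 * (B * w)) := by
    refine Nat.cast_div_le.trans ?_
    rw [div_le_div_iff₀ hA0 (by positivity)]
    have := mul_le_mul_of_nonneg_left hA1 (Nat.cast_nonneg (α := ℝ) N)
    linarith
  have hnAS : ((N / (L.A * Nat.size (Nat.size N)) : ℕ) : ℝ) ≤
      (q + 2) * N / (4 * (B * w)) / Nat.size (Nat.size N) := by
    rw [← Nat.div_div_eq_div_mul]
    exact Nat.cast_div_le.trans (div_le_div_of_nonneg_right hnA (by positivity))
  have hg : (L.g : ℝ) * Nat.size N ≤ 2 * ((N : ℝ) / h + 3) + Nat.size N := by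
    have h1 : L.g * Nat.size N ≤ 2 * (N / h + 3) + Nat.size N := by
      rw [hL]
      show (2 * (N / h + 3) / Nat.size N + 1) * Nat.size N ≤ _
      have := Nat.div_mul_le_self (2 * (N / h + 3)) (Nat.size N)
      rw [Nat.add_mul, Nat.one_mul]
      omega
    have h2 : (L.g : ℝ) * Nat.size N ≤ 2 * (((N / h : ℕ) : ℝ) + 3) + Nat.size N := by
      exact_mod_cast h1
    have h3 : ((N / h : ℕ) : ℝ) ≤ N / h := Nat.cast_div_le
    linarith
  have ht : ((2 * N / Nat.size N ^ 2 : ℕ) : ℝ) ≤ 2 * N / (Nat.size N : ℝ) ^ 2 := by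
    have := Nat.cast_div_le (α := ℝ) (m := 2 * N) (n := Nat.size N ^ 2)
    push_cast at this
    exact this
  rw [← hL] at hX hXw
  rw [hsum]
  have t1 := headBits_bound (Nat.cast_nonneg a) hu0 hnr hSr hBr hwr hnA hnw hnB
  have t2 := nearBits_bound hu0 hnr hSr hBr hwr hnA hnw hnB hτ hτ1 hhr.le hh1
    (by positivity) (Nat.cast_nonneg _) hX hXw
  have t3 := farBits_bound hu0 hnr hSr hBr hwr hnAS hnw hhr.le hhBr
  have t4 := monoBits_bound (Nat.cast_nonneg N) hnr hSr hBr hτ hhr hh2 hnB (Nat.cast_nonneg L.g)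
    hg ht
  have hu1 : (q + 2) * N * Nat.size (Nat.size N) / Nat.size N ≤
      8 * (((q : ℝ) + 2) * lowOrder N) := by
    have := mul_le_mul_of_nonneg_left hZ1 (show (0 : ℝ) ≤ q + 2 by linarith)
    calc _ = ((q : ℝ) + 2) * ((N : ℝ) * Nat.size (Nat.size N) / Nat.size N) := by ring
      _ ≤ _ := by linarith
  have hu3 : ((q : ℝ) + 2) * N / Nat.size (Nat.size N) = (q + 2) * lowOrder N := by
    rw [lowOrder]; ring
  have hqZ : lowOrder N ≤ ((q : ℝ) + 2) * lowOrder N :=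
    le_mul_of_one_le_left hZ0 (by linarith)
  rw [hu3] at t3
  have r1 := mul_le_mul_of_nonneg_left hu1 (show (0 : ℝ) ≤ 2 * (a * a') by positivity)
  have r2 := mul_le_mul_of_nonneg_left hu1
    (show (0 : ℝ) ≤ (3 + Nat.size (3 * (d * a'))) * a by positivity)
  have r3 := mul_le_mul_of_nonneg_left hu1 (show (0 : ℝ) ≤ ((4 + d) * a + e) * a' by positivity)
  have r4 := mul_le_mul_of_nonneg_left (show (N : ℝ) * Nat.size (Nat.size N) / Nat.size N ≤
    8 * (((q : ℝ) + 2) * lowOrder N) by linarith) (show (0 : ℝ) ≤ 56 * a' / τ by positivity)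
  have r5 : τ * ((q + 2) * N) * (q + 2 * lg B) / (4 * w) =
      τ * N * (q + 2) * (q + 2 * lg B) / (4 * w) := by ring
  rw [r5] at t2
  have r6 : (q + 2) * ((16 * a * a' + 8 * ((4 + d) * a + e) * a' +
      8 * (3 + Nat.size (3 * (d * a'))) * a + a + 448 * a' / τ + 10000) * lowOrder N) =
      2 * (a * a') * (8 * ((q + 2) * lowOrder N)) +
      ((4 + d) * a + e) * a' * (8 * ((q + 2) * lowOrder N)) +
      (3 + Nat.size (3 * (d * a'))) * a * (8 * ((q + 2) * lowOrder N)) +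
      a * ((q + 2) * lowOrder N) +
      56 * a' / τ * (8 * ((q + 2) * lowOrder N)) + 10000 * ((q + 2) * lowOrder N) := by ring
  rw [r6]
  linarith

end SizeAssumptions

/-! ### The representation theorem -/

theorem exists_layerHeight {τ : ℝ} {B : ℕ} (hτ : 0 < τ) (hτ1 : τ < 1) (hB : 0 < B) :
    ∃ h : ℕ, 1 ≤ h ∧ (h : ℝ) ≤ max 1 (τ * B) ∧ h ≤ B ∧ (h : ℝ) ≤ τ * B + 1 ∧ τ * B ≤ 2 * h := by
  have hB' : (1 : ℝ) ≤ B := by exact_mod_cast hB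
  have hτB : 0 < τ * B := by positivity
  have hle : τ * B ≤ B := mul_le_of_le_one_left (by positivity) hτ1.le
  rcases lt_or_ge (τ * B) 1 with h1 | h1
  · refine ⟨1, le_rfl, ?_, hB, ?_, ?_⟩ <;> push_cast
    · exact le_max_left _ _
    · linarith
    · linarith
  · have h2 := Nat.floor_le hτB.le
    have h3 := Nat.lt_floor_add_one (τ * B)
    have h4 : 1 ≤ ⌊τ * B⌋₊ := Nat.le_floor (by exact_mod_cast h1)
    have h5 : (1 : ℝ) ≤ ⌊τ * B⌋₊ := by exact_mod_cast h4
    refine ⟨⌊τ * B⌋₊, h4, h2.trans (le_max_right _ _), ?_, by linarith, by linarith⟩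
    exact_mod_cast h2.trans hle

/-- The common generalization of both parts of the theorem: keys of any length `q ≥ 0`, an arbitrary
form of the reported items, and any internal memory of sufficient size. -/
theorem exists_representation (cB cw Cw Cq : ℝ) (hcB : 0 < cB) (hcw : 0 < cw) :
    ∃ C : ℕ, ∀ τ : ℝ, 0 < τ → τ < 1 → ∃ K : ℝ,
      ∀ N B w q m : ℕ, ModelAssumptions cB cw Cw N B w → (q : ℝ) ≤ Cq * lg N → C * B * w ≤ m →
      ∃ h : ℕ, 1 ≤ h ∧ (h : ℝ) ≤ max 1 (τ * B) ∧
      ∀ (O : Type) (out : ℕ × ℕ → BitVec q → O), ∃ P : DiskProgram (ℕ × ℕ) O (B * w) m,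
      ∀ T : OrdinalTree, T.nodes.card = N → ∀ key : List ℕ → BitVec q,
      ∃ r : ℕ, 1 ≤ r ∧ r ≤ h ∧ ∃ D : List Bool,
        (D.length : ℝ) ≤ (2 + q) * N + τ * N * (q + 2) * (q + 2 * lg B) / (4 * w) +
          (q + 2) * (K * lowOrder N) ∧
        P.ReportsRootPaths D T h r (fun v => out (T.ident h r v) (key v))
          fun k => C * (k / (τ * B) + 1) := by
  let a := ⌈2 / cw⌉₊
  let d := ⌈Cw⌉₊
  let a' := ⌈2 / cB⌉₊
  let e := ⌈Cq⌉₊ * ⌈2 / cw⌉₊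
  let R := 3 * (12 * a + 4 * a) + 8 * a + 7 + (4 + e) + ((4 + d) * a + e) + 4 * a + 22
  refine ⟨3 + 2 * a + 2 * R, fun τ hτ hτ1 =>
    ⟨16 * a * a' + 8 * ((4 + d) * a + e) * a' + 8 * (3 + Nat.size (3 * (d * a'))) * a + a +
      448 * a' / τ + 10000, fun N B w q m hH hq hm => ?_⟩⟩
  have H : SizeAssumptions a d a' e N B w q := sizeAssumptions_of_model hcB hcw hH hq
  obtain ⟨h, hh1, hhmax, hhB, hhu, hhl⟩ := exists_layerHeight hτ hτ1 H.block_pos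
  refine ⟨h, hh1, hhmax, fun O out => ?_⟩
  have hcost : (stdLayout N B w q h).roundCost (B * w) ≤ R := H.roundCost_le hhB
  have hβ : 0 < B * w := Nat.mul_pos H.block_pos H.word_pos
  have hn2 := two_le_size H.two_le
  have hMg : 2 * (N / h + 3) ≤ (2 * (N / h + 3) / Nat.size N + 1) * Nat.size N := by
    have := Nat.lt_div_mul_add (a := 2 * (N / h + 3)) (b := Nat.size N) (by omega)
    rw [Nat.add_mul, Nat.one_mul]
    omega
  have hmem : 1 + 2 * Nat.size (N + 1) + (stdLayout N B w q h).roundCost (B * w) +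
      (stdLayout N B w q h).roundCost (B * w) * (B * w) ≤ m := by
    refine le_trans ?_ hm
    have h1 : Nat.size (N + 1) ≤ Nat.size N + 1 := by
      rw [Nat.size_le, pow_succ]
      have := Nat.lt_size_self N
      omega
    have h2 : Nat.size N ≤ a * (B * w) :=
      H.size_le_word.trans (Nat.mul_le_mul_left _ (Nat.le_mul_of_pos_left _ H.block_pos))
    have h3 : R ≤ R * (B * w) := Nat.le_mul_of_pos_right _ hβ
    have h4 := Nat.mul_le_mul_right (B * w) hcost
    have h5 : (3 + 2 * a + 2 * R) * B * w = 3 * (B * w) + 2 * (a * (B * w)) +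
        2 * (R * (B * w)) := by ring
    omega
  obtain ⟨P, hP⟩ := (stdLayout N B w q h).exists_reportsRootPaths (stdLayout_valid H.two_le B w q h)
    hβ hh1 hMg (Nat.lt_succ_self _) hmem out
  refine ⟨P, fun T hT key => ?_⟩
  obtain ⟨r, hr1, hrh, D, hD, hrep⟩ := hP T hT key
  refine ⟨r, hr1, hrh, D, ?_, fun u hu => ?_⟩
  · exact (Nat.cast_le.2 hD).trans (H.length_le hτ hτ1 hhB hhu hhl hh1 rfl)
  · obtain ⟨n, hn, hrun⟩ := hrep u hu
    refine ⟨n, hn.trans ?_, hrun⟩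
    have hB0 : (0 : ℝ) < B := by exact_mod_cast H.block_pos
    have hh0 : (0 : ℝ) < h := by exact_mod_cast hh1
    have h1 : ((u.length / h : ℕ) : ℝ) ≤ 2 * (u.length / (τ * B)) := by
      refine Nat.cast_div_le.trans ?_
      rw [← mul_div_assoc, div_le_div_iff₀ hh0 (by positivity)]
      have := mul_le_mul_of_nonneg_left hhl (Nat.cast_nonneg (α := ℝ) u.length)
      linarith
    have h2 : (((stdLayout N B w q h).roundCost (B * w) + 1 : ℕ) : ℝ) ≤ R + 1 := by
      exact_mod_cast Nat.succ_le_succ hcost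
    have h3 : (0 : ℝ) ≤ u.length / (τ * B) := by positivity
    show (((u.length / h + 2 : ℕ) : ℝ)) *
      (((stdLayout N B w q h).roundCost (B * w) + 1 : ℕ) : ℝ) ≤ _
    calc _ ≤ (2 * (u.length / (τ * B)) + 2) * (R + 1 : ℝ) := by
          refine mul_le_mul ?_ h2 (by positivity) (by positivity)
          push_cast
          linarith
      _ = (2 + 2 * R) * (u.length / (τ * B) + 1) := by ring
      _ ≤ _ := by
          refine mul_le_mul_of_nonneg_right ?_ (by linarith)
          push_cast
          linarith [(Nat.cast_nonneg a : (0 : ℝ) ≤ a)]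

theorem mainTheorem1 :
    -- trees with `q`-bit keys
    (∀ cB cw Cw Cq : ℝ, 0 < cB → 0 < cw →
      ∃ C : ℕ, ∀ τ : ℝ, 0 < τ → τ < 1 →
      ∃ f : ℕ → ℝ, f =o[Filter.atTop] (fun N : ℕ => (N : ℝ)) ∧
      ∀ N B w q : ℕ, ModelAssumptions cB cw Cw N B w → 1 ≤ q → (q : ℝ) ≤ Cq * lg N →
      ∃ h : ℕ, 1 ≤ h ∧ (h : ℝ) ≤ max 1 (τ * B) ∧
      ∃ P : DiskProgram (ℕ × ℕ) ((ℕ × ℕ) × BitVec q) (B * w) (C * B * w),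
      ∀ T : OrdinalTree, T.nodes.card = N → ∀ key : List ℕ → BitVec q,
      ∃ r : ℕ, 1 ≤ r ∧ r ≤ h ∧ ∃ D : List Bool,
        (D.length : ℝ) ≤ (2 + q) * N + q * (2 * τ * N * (q + 2 * lg B) / w + f N)
          + 8 * τ * N * lg B / w ∧
        P.ReportsRootPaths D T h r (fun v => (T.ident h r v, key v))
          (fun K => C * (K / (τ * B) + 1))) ∧
    -- trees without keys
    (∀ cB cw Cw : ℝ, 0 < cB → 0 < cw → ∀ ε : ℝ, 0 < ε → ε < 1 →
      ∃ C : ℕ, ∃ f : ℕ → ℝ, f =o[Filter.atTop] (fun N : ℕ => (N : ℝ)) ∧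
      ∀ N B w : ℕ, ModelAssumptions cB cw Cw N B w →
      ∃ h : ℕ, 1 ≤ h ∧ (h : ℝ) ≤ max 1 (ε * B) ∧
      ∃ P : DiskProgram (ℕ × ℕ) (ℕ × ℕ) (B * w) (C * B * w),
      ∀ T : OrdinalTree, T.nodes.card = N →
      ∃ r : ℕ, 1 ≤ r ∧ r ≤ h ∧ ∃ D : List Bool,
        (D.length : ℝ) ≤ 2 * N + ε * N * lg B / w + f N ∧
        P.ReportsRootPaths D T h r (fun v => T.ident h r v)
          (fun K => C * (K / B + 1))) := by
  refine ⟨fun cB cw Cw Cq hcB hcw => ?_, fun cB cw Cw hcB hcw ε hε hε1 => ?_⟩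
  · obtain ⟨C, hC⟩ := exists_representation cB cw Cw Cq hcB hcw
    refine ⟨C, fun τ hτ hτ1 => ?_⟩
    obtain ⟨K, hK⟩ := hC τ hτ hτ1
    -- the absolute value spares a proof that `K` is nonnegative
    refine ⟨fun N => 3 * |K| * lowOrder N, lowOrder_isLittleO _, fun N B w q hH hq1 hq => ?_⟩
    obtain ⟨h, hh1, hh, hP⟩ := hK N B w q _ hH hq le_rfl
    obtain ⟨P, hP⟩ := hP _ Prod.mk
    refine ⟨h, hh1, hh, P, fun T hT key => ?_⟩
    obtain ⟨r, hr1, hrh, D, hD, hrep⟩ := hP T hT key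
    refine ⟨r, hr1, hrh, D, hD.trans ?_, hrep⟩
    have H := sizeAssumptions_of_model hcB hcw hH hq
    have hw : (0 : ℝ) < w := by exact_mod_cast H.word_pos
    have hlg : 0 ≤ lg B := Real.logb_nonneg (by norm_num) (by exact_mod_cast H.block_pos)
    have hZ := (SizeAssumptions.lowOrder_bounds H.two_le).1
    have hq1' : (1 : ℝ) ≤ q := by exact_mod_cast hq1
    have e1 : ((q : ℝ) + 2) * (K * lowOrder N) ≤ q * (3 * |K| * lowOrder N) := by
      have h1 : K * lowOrder N ≤ |K| * lowOrder N := mul_le_mul_of_nonneg_right (le_abs_self K) hZ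
      have h2 : 0 ≤ |K| * lowOrder N := mul_nonneg (abs_nonneg K) hZ
      calc ((q : ℝ) + 2) * (K * lowOrder N) ≤ (q + 2) * (|K| * lowOrder N) :=
            mul_le_mul_of_nonneg_left h1 (by linarith)
        _ ≤ (3 * q) * (|K| * lowOrder N) := mul_le_mul_of_nonneg_right (by linarith) h2
        _ = _ := by ring
    have e2 : τ * N * (q + 2) * (q + 2 * lg B) / (4 * w) ≤
        q * (2 * τ * N * (q + 2 * lg B) / w) + 8 * τ * N * lg B / w := by
      have h1 : ((q : ℝ) + 2) * (q + 2 * lg B) ≤ 8 * q * (q + 2 * lg B) + 32 * lg B := by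
        have h2 : ((q : ℝ) + 2) * (q + 2 * lg B) ≤ (8 * q) * (q + 2 * lg B) :=
          mul_le_mul_of_nonneg_right (by linarith) (by linarith)
        linarith
      have h3 : 0 ≤ τ * N / (4 * w) := by positivity
      calc τ * N * (q + 2) * (q + 2 * lg B) / (4 * w) =
            τ * N / (4 * w) * ((q + 2) * (q + 2 * lg B)) := by ring
        _ ≤ τ * N / (4 * w) * (8 * q * (q + 2 * lg B) + 32 * lg B) :=
            mul_le_mul_of_nonneg_left h1 h3
        _ = _ := by field_simp; ring
    simp only [mul_add (q : ℝ) (2 * τ * N * (q + 2 * lg B) / w)]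
    linarith
  · obtain ⟨C, hC⟩ := exists_representation cB cw Cw 0 hcB hcw
    obtain ⟨K, hK⟩ := hC ε hε hε1
    have hCε : (C : ℝ) / ε ≤ ⌈(C : ℝ) / ε⌉₊ := Nat.le_ceil _
    have hC' : C ≤ ⌈(C : ℝ) / ε⌉₊ := by
      have : (C : ℝ) ≤ C / ε := by
        rw [le_div_iff₀ hε]
        exact mul_le_of_le_one_right (by positivity) hε1.le
      exact_mod_cast this.trans hCε
    refine ⟨⌈(C : ℝ) / ε⌉₊, fun N => 2 * K * lowOrder N, lowOrder_isLittleO _, fun N B w hH => ?_⟩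
    obtain ⟨h, hh1, hh, hP⟩ := hK N B w 0 (⌈(C : ℝ) / ε⌉₊ * B * w) hH (by simp)
      (Nat.mul_le_mul_right _ (Nat.mul_le_mul_right _ hC'))
    obtain ⟨P, hP⟩ := hP _ fun x _ => x
    refine ⟨h, hh1, hh, P, fun T hT => ?_⟩
    obtain ⟨r, hr1, hrh, D, hD, hrep⟩ := hP T hT fun _ => 0
    refine ⟨r, hr1, hrh, D, hD.trans (le_of_eq ?_), fun u hu => ?_⟩
    · push_cast
      ring
    · obtain ⟨n, hn, hrun⟩ := hrep u hu
      refine ⟨n, hn.trans ?_, hrun⟩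
      have h1 : (0 : ℝ) ≤ u.length / B := by positivity
      calc (C : ℝ) * (u.length / (ε * B) + 1) = C / ε * (u.length / B) + C := by field_simp
        _ ≤ ⌈(C : ℝ) / ε⌉₊ * (u.length / B) + ⌈(C : ℝ) / ε⌉₊ :=
            add_le_add (mul_le_mul_of_nonneg_right hCε h1) (by exact_mod_cast hC')
        _ = _ := by ring
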